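/- \textbf{Setting.} Let $n,d\in\mathbb N$. Let $\mathcal G$ be a DAG on $[n]$ with parent sets $\mathrm{Pa}(i)$, and for each $i$ let $p_i(z_i\mid z_{\mathrm{Pa}(i)})$ be a strictly positive conditional density that is continuously differentiable in all its variables; put $p(z)=\prod_i p_i(z_i\mid z_{\mathrm{Pa}(i)})$. For each $i$ let $q_i,\tilde q_i$ be strictly positive, continuously differentiable probability densities on $\mathbb R$ satisfying interventional discrepancy: $\frac{d}{du}\frac{q_i(u)}{\tilde q_i(u)}\neq 0$ for Lebesgue-almost every $u$. Let $I$ be an (unknown) permutation of $[n]$. For $m\in[n]$, with $\ell=I(m)$, the coupled hard-intervention environments $\mathcal E^m$ and $\tilde{\mathcal E}^m$ have latent densities $q_\ell(z_\ell)\prod_{i\ne\ell}p_i(z_i\mid z_{\mathrm{Pa}(i)})$ and $\tilde q_\ell(z_\ell)\prod_{i\ne\ell}p_i(z_i\mid z_{\mathrm{Pa}(i)})$. Let $g:\mathbb R^n\to\mathbb R^d$ be continuously differentiable and a diffeomorphism onto its image $\mathcal X=g(\mathbb R^n)$. One observes the set $\mathcal X$ and, for every $m$, the laws of $X=g(Z)$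 in $\mathcal E^m$ and in $\tilde{\mathcal E}^m$; neither $\mathcal G$, $I$, $g$, the mechanisms, nor the observational law of $X$ is available. A \emph{valid encoder} is a map $h:\mathbb R^d\to\mathbb R^n$ that on $\mathcal X$ is the inverse of some continuously differentiable map $\mathbb R^n\to\mathbb R^d$ that is a diffeomorphism onto its image $\mathcal X$. A map $h:\mathbb R^d\to\mathbb R^n$ \emph{recovers $Z$ via} a permutation $\pi$ of $[n]$ if there are $C^1$-diffeomorphisms $\phi_1,\dots,\phi_n$ of $\mathbb R$ with $h(g(z))_m=\phi_m(z_{\pi(m)})$ for all $z\in\mathbb R^n$ and $m\in[n]$; it \emph{achieves componentwise latent recovery} if it does so for some $\pi$. For two laws $\mu,\nu$ on $\mathbb R^n$ whose log-density ratio $\log\frac{d\mu}{d\nu}$ has a $C^1$ version, the difference of their score functions means $\nabla\log\frac{d\mu}{d\nu}$, and the scores \emph{differ in coordinate $k$} if $\mathbb E_\nu\big|\partial_k\log\frac{d\mu}{d\nu}\big|\neq0$. \textbf{Theorem (No Observational Data).} (1) There is an estimator, a function of $\mathcal X$ and of the $2n$ interventional laws of $X$ only, whose value $\hat h$ achieves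 componentwise latent recovery for every model as above. It can be taken to be a valid encoder such that for every $m$ the scores of $\hat h(X)$ in $\mathcal E^m$ and $\tilde{\mathcal E}^m$ differ exactly in coordinate $m$; and every valid encoder with this property achieves componentwise latent recovery. (2) For each $n$ there is a procedure which, for any map $h$ that recovers $Z$ via some permutation, takes as input the set of all triples $(a,b,k)\in[n]^3$ such that the scores of $h(X)$ in $\mathcal E^a$ and in $\tilde{\mathcal E}^b$ differ in coordinate $k$, then performs, adaptively, at most $2n-1$ tests (none if $n=0$), each asking whether two coordinates of $h(X)$ are conditionally independent given a set of coordinates in one of the $2n$ interventional environments, and outputs a directed graph $\hat{\mathcal G}$ on $[n]$, such that the following holds for every model as above. Suppose in addition that the latent model has additive noise ($Z_i=f_i(Z_{\mathrm{Pa}(i)})+N_i$ with $N_i$ independent of $Z_{\mathrm{Pa}(i)}$ and having a density of full support), that $p$ is twice differentiable, and that $p$ is adjacency-faithful to $\mathcal G$ (whenever $i,j$ are adjacent in $\mathcal G$, $Z_i$ and $Z_j$ are dependent given $Z_S$ under $p$ for every $S\subseteq[n]\setminus\{i,j\}$). Then, for every $h$ that recovers $Z$ via a permutation $\pi$, the output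 is isomorphic to $\mathcal G$ via $\pi$: $a\to b$ in $\hat{\mathcal G}$ if and only if $\pi(a)\to\pi(b)$ in $\mathcal G$. -/

import Mathlib

open MeasureTheory ProbabilityTheory
open scoped Manifold

/-! ### Latent causal models -/

/-- A strictly positive, continuously differentiable probability density on the real line. -/
structure IsPosPdf (q : ℝ → ℝ) : Prop where
  pos : ∀ u, 0 < q u
  contDiff : ContDiff ℝ 1 q
  lintegral_eq_one : ∫⁻ u, ENNReal.ofReal (q u) = 1

/-- Interventional discrepancy of two mechanisms: the derivative of the ratio of the two
densities is nonzero outside a Lebesgue-null set. -/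
def InterventionalDiscrepancy (p q : ℝ → ℝ) : Prop :=
  ∀ᵐ u, deriv (fun v => p v / q v) u ≠ 0

/-- A latent causal model on the nodes `Fin n`: a DAG (`graph.Adj j i` is the edge `j → i`) and,
for every node `i`, the conditional density `mech i z = p_i(z_i | z_{Pa(i)})`, written as a function
of the whole vector `z` that depends on `z_i` and on the parents of `i` only. -/
structure CausalModel (n : ℕ) where
  graph : Digraph (Fin n)
  acyclic : ∀ i, ¬ Relation.TransGen graph.Adj i i
  mech : Fin n → (Fin n → ℝ) → ℝ
  mech_local : ∀ i z w, z i = w i → (∀ j, graph.Adj j i → z j = w j) → mech i z = mech i w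
  mech_pos : ∀ i z, 0 < mech i z
  mech_contDiff : ∀ i, ContDiff ℝ 1 (mech i)
  mech_lintegral : ∀ i z, ∫⁻ t, ENNReal.ofReal (mech i (Function.update z i t)) = 1

namespace CausalModel

variable {n : ℕ}

/-- The observational density `p(z) = ∏ i, p_i(z_i | z_{Pa(i)})`. -/
noncomputable def density (M : CausalModel n) (z : Fin n → ℝ) : ℝ :=
  ∏ i, M.mech i z

/-- The observational law of the latent vector. -/
noncomputable def law (M : CausalModel n) : Measure (Fin n → ℝ) :=
  volume.withDensity (fun z => ENNReal.ofReal (M.density z))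

/-- The density after a hard intervention on node `l` with the new mechanism `q`:
`q(z_l) ∏_{i ≠ l} p_i(z_i | z_{Pa(i)})`. -/
noncomputable def hardDensity (M : CausalModel n) (l : Fin n) (q : ℝ → ℝ) (z : Fin n → ℝ) : ℝ :=
  q (z l) * ∏ i ∈ Finset.univ.erase l, M.mech i z

/-- The law of the latent vector after a hard intervention on node `l`. -/
noncomputable def hardLaw (M : CausalModel n) (l : Fin n) (q : ℝ → ℝ) : Measure (Fin n → ℝ) :=
  volume.withDensity (fun z => ENNReal.ofReal (M.hardDensity l q z))

/-- Additive noise, `Z_i = f_i(Z_{Pa(i)}) + N_i` where `N_i` is independent of the parents and has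
a density `ρ_i` of full support: the conditional density of `Z_i` given its parents is the
translate of `ρ_i` by `f_i`. -/
def AdditiveNoise (M : CausalModel n) : Prop :=
  ∀ i, ∃ (f : (Fin n → ℝ) → ℝ) (ρ : ℝ → ℝ),
    Measurable f ∧ (∀ z w, (∀ j, M.graph.Adj j i → z j = w j) → f z = f w) ∧
    Measurable ρ ∧ (∀ u, 0 < ρ u) ∧ ∫⁻ u, ENNReal.ofReal (ρ u) = 1 ∧
    ∀ z, M.mech i z = ρ (z i - f z)

/-- The observational density is twice differentiable. -/
def TwiceDifferentiable (M : CausalModel n) : Prop :=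
  Differentiable ℝ M.density ∧ Differentiable ℝ (fderiv ℝ M.density)

theorem lintegral_prod_kernels (G : Digraph (Fin n)) (hG : ∀ i, ¬ Relation.TransGen G.Adj i i)
    (K : Fin n → (Fin n → ℝ) → ENNReal) (hm : ∀ i, Measurable (K i))
    (hloc : ∀ i z w, z i = w i → (∀ j, G.Adj j i → z j = w j) → K i z = K i w)
    (hone : ∀ i z, ∫⁻ t, K i (Function.update z i t) = 1) :
    ∫⁻ z, ∏ i, K i z = 1 := by
  have key : ∀ (c : ℕ) (T : Finset (Fin n)), T.card = c → ∀ z,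
      lmarginal (fun _ : Fin n => (volume : Measure ℝ)) T (fun z => ∏ i ∈ T, K i z) z = 1 := by
    intro c
    induction c with
    | zero =>
      intro T hT z
      rw [Finset.card_eq_zero] at hT
      subst hT
      simp
    | succ c ih =>
      intro T hT z
      have hne : T.Nonempty := by
        rw [← Finset.card_pos]; omega
      have hwf : WellFounded (fun a b => Relation.TransGen G.Adj b a) := by
        have : IsTrans (Fin n) (fun a b => Relation.TransGen G.Adj b a) :=
          ⟨fun a b c h1 h2 => h2.trans h1⟩
        have : Std.Irrefl (fun a b => Relation.TransGen G.Adj b a) := ⟨fun a h => hG a h⟩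
        exact Finite.wellFounded_of_trans_of_irrefl _
      obtain ⟨i, hiT, hi⟩ := hwf.has_min (T : Set (Fin n)) hne
      have hiT' : i ∈ T := hiT
      have hsplit : T = insert i (T.erase i) := (Finset.insert_erase hiT').symm
      have hmeas : Measurable (fun z => ∏ k ∈ T, K k z) :=
        Finset.measurable_prod _ (fun k _ => hm k)
      have hfun : (fun x : Fin n → ℝ => ∫⁻ t, ∏ k ∈ T, K k (Function.update x i t))
          = fun x => ∏ k ∈ T.erase i, K k x := by
        funext x
        have h1 : ∀ t, ∏ k ∈ T, K k (Function.update x i t)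
            = K i (Function.update x i t) * ∏ k ∈ T.erase i, K k x := by
          intro t
          rw [← Finset.mul_prod_erase T _ hiT']
          congr 1
          refine Finset.prod_congr rfl (fun k hk => ?_)
          have hki : k ≠ i := Finset.ne_of_mem_erase hk
          refine hloc k _ _ (Function.update_of_ne hki _ _) (fun j hj => ?_)
          refine Function.update_of_ne (fun hji => ?_) _ _
          subst hji
          exact hi k (Finset.mem_of_mem_erase hk) (Relation.TransGen.single hj)
        simp_rw [h1]
        have hmi : Measurable (fun t : ℝ => K i (Function.update x i t)) :=
          (hm i).comp (measurable_update x)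
        rw [lintegral_mul_const _ hmi, hone, one_mul]
      have hins := lmarginal_insert' (μ := fun _ : Fin n => (volume : Measure ℝ))
        (fun z => ∏ k ∈ T, K k z) hmeas (Finset.notMem_erase i T)
      rw [← hsplit] at hins
      rw [hins, hfun]
      exact ih _ (by rw [Finset.card_erase_of_mem hiT', hT]; rfl) z
  have := key _ Finset.univ rfl 0
  rw [lmarginal_univ] at this
  exact this

instance (M : CausalModel n) : IsProbabilityMeasure M.law := by
  refine ⟨?_⟩
  rw [law, withDensity_apply _ MeasurableSet.univ, Measure.restrict_univ]
  simp only [density, ENNReal.ofReal_prod_of_nonneg (fun i _ => (M.mech_pos i _).le)]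
  refine lintegral_prod_kernels M.graph M.acyclic (fun i z => ENNReal.ofReal (M.mech i z))
    (fun i => (M.mech_contDiff i).continuous.measurable.ennreal_ofReal) ?_ M.mech_lintegral
  intro i z w h1 h2
  simp only [M.mech_local i z w h1 h2]

theorem isProbabilityMeasure_hardLaw (M : CausalModel n) (l : Fin n) {q : ℝ → ℝ}
    (hq : IsPosPdf q) : IsProbabilityMeasure (M.hardLaw l q) := by
  refine ⟨?_⟩
  rw [hardLaw, withDensity_apply _ MeasurableSet.univ, Measure.restrict_univ]
  have h := lintegral_prod_kernels M.graph M.acyclic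
    (Function.update (fun i z => ENNReal.ofReal (M.mech i z)) l
      (fun z => ENNReal.ofReal (q (z l)))) ?_ ?_ ?_
  · rw [← h]
    refine lintegral_congr (fun z => ?_)
    rw [hardDensity, ENNReal.ofReal_mul (hq.pos _).le,
      ENNReal.ofReal_prod_of_nonneg (fun i _ => (M.mech_pos i _).le),
      ← Finset.mul_prod_erase Finset.univ _ (Finset.mem_univ l), Function.update_self]
    congr 1
    refine Finset.prod_congr rfl (fun k hk => ?_)
    rw [Function.update_of_ne (Finset.ne_of_mem_erase hk)]
  · intro i
    by_cases hi : i = l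
    · subst hi
      rw [Function.update_self]
      exact (hq.contDiff.continuous.measurable.comp (measurable_pi_apply i)).ennreal_ofReal
    · rw [Function.update_of_ne hi]
      exact (M.mech_contDiff i).continuous.measurable.ennreal_ofReal
  · intro i z w h1 h2
    by_cases hi : i = l
    · subst hi
      simp only [Function.update_self, h1]
    · simp only [Function.update_of_ne hi, M.mech_local i z w h1 h2]
  · intro i z
    by_cases hi : i = l
    · subst hi
      simp only [Function.update_self]
      exact hq.lintegral_eq_one
    · simp only [Function.update_of_ne hi]
      exact M.mech_lintegral i z

end CausalModel

/-! ### Conditional independence, adjacency-faithfulness, score differences -/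

/-- The σ-algebra generated by the coordinates in `S`. -/
abbrev coordSigma {n : ℕ} (S : Finset (Fin n)) : MeasurableSpace (Fin n → ℝ) :=
  ⨆ k ∈ S, MeasurableSpace.comap (fun z : Fin n → ℝ => z k) inferInstance

theorem coordSigma_le {n : ℕ} (S : Finset (Fin n)) :
    coordSigma S ≤ (inferInstance : MeasurableSpace (Fin n → ℝ)) :=
  iSup₂_le fun k _ => (measurable_pi_apply k).comap_le

/-- Under `μ`, the coordinates `i` and `j` are conditionally independent given those in `S`. -/
def CondIndepCoord {n : ℕ} (μ : Measure (Fin n → ℝ)) [IsFiniteMeasure μ]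
    (i j : Fin n) (S : Finset (Fin n)) : Prop :=
  CondIndepFun (coordSigma S) (coordSigma_le S)
    (fun z : Fin n → ℝ => z i) (fun z : Fin n → ℝ => z j) μ

/-- Adjacency-faithfulness of the observational law to the DAG: adjacent nodes are dependent given
every set of the other nodes. -/
def CausalModel.AdjacencyFaithful {n : ℕ} (M : CausalModel n) : Prop :=
  ∀ i j, M.graph.Adj i j → ∀ S : Finset (Fin n), i ∉ S → j ∉ S → ¬ CondIndepCoord M.law i j S

/-- `r` is a continuously differentiable version of `log (dμ/dν)`. Its gradient is the difference
of the score functions of `μ` and `ν`. (When densities are transported by a map that is merely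
continuously differentiable, the difference of scores still makes sense in this form.) -/
def IsLogRatio {n : ℕ} (μ ν : Measure (Fin n → ℝ)) (r : (Fin n → ℝ) → ℝ) : Prop :=
  ContDiff ℝ 1 r ∧ μ = ν.withDensity (fun z => ENNReal.ofReal (Real.exp (r z)))

/-- The score functions of `μ` and `ν` differ in coordinate `k`: the expectation (under `ν`) of the
absolute value of coordinate `k` of the score difference is nonzero. -/
def ScoreDiffers {n : ℕ} (μ ν : Measure (Fin n → ℝ)) (k : Fin n) : Prop :=
  ∃ r, IsLogRatio μ ν r ∧ ∫⁻ z, ‖fderiv ℝ r z (Pi.single k 1)‖ₑ ∂ν ≠ 0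

/-! ### Decoders, encoders and the observed data -/

/-- `g` is continuously differentiable and a diffeomorphism onto its image. -/
structure IsDecoder {n d : ℕ} (g : (Fin n → ℝ) → (Fin d → ℝ)) : Prop where
  contDiff : ContDiff ℝ 1 g
  isEmbedding : Topology.IsEmbedding g
  fderiv_injective : ∀ z, Function.Injective (fderiv ℝ g z)

/-- `h` is a valid encoder for the observation manifold `X`: on `X` it is the inverse of a
decoder with image `X`. -/
def IsValidEncoder {n d : ℕ} (X : Set (Fin d → ℝ)) (h : (Fin d → ℝ) → (Fin n → ℝ)) : Prop :=
  ∃ g : (Fin n → ℝ) → (Fin d → ℝ), IsDecoder g ∧ Set.range g = X ∧ ∀ z, h (g z) = z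

/-- `h` is a valid encoder whose score change matrix across the environment pairs has the
zero pattern of the identity matrix: for all `m`, the scores of the encoded data in the first and
second environment number `m` differ exactly in coordinate `m`. It refers to the observation
manifold `X` and to the laws `P m`, `P' m` of the observations in the `2n` environments only. -/
def IsScoreEncoder {n d : ℕ} (X : Set (Fin d → ℝ)) (P P' : Fin n → Measure (Fin d → ℝ))
    (h : (Fin d → ℝ) → (Fin n → ℝ)) : Prop :=
  IsValidEncoder X h ∧
    ∀ m k, ScoreDiffers ((P m).map h) ((P' m).map h) k ↔ k = m

/-- A latent causal model with two coupled hard interventions per node, and a decoder.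
In both environments number `m` the node `target m` is intervened on; its mechanism becomes
`q (target m)` in the first one and `q' (target m)` in the second one. -/
structure CoupledModel (n d : ℕ) extends CausalModel n where
  q : Fin n → ℝ → ℝ
  q' : Fin n → ℝ → ℝ
  q_pdf : ∀ i, IsPosPdf (q i)
  q'_pdf : ∀ i, IsPosPdf (q' i)
  target : Equiv.Perm (Fin n)
  g : (Fin n → ℝ) → (Fin d → ℝ)
  g_decoder : IsDecoder g

namespace CoupledModel

variable {n d : ℕ}

/-- The observation manifold, the image of the decoder. -/
def manifold (M : CoupledModel n d) : Set (Fin d → ℝ) := Set.range M.g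

/-- The law of the observations `X = g(Z)` in the first environment number `m`. -/
noncomputable def obsLaw (M : CoupledModel n d) (m : Fin n) : Measure (Fin d → ℝ) :=
  (M.hardLaw (M.target m) (M.q (M.target m))).map M.g

/-- The law of the observations `X = g(Z)` in the second environment number `m`. -/
noncomputable def obsLaw' (M : CoupledModel n d) (m : Fin n) : Measure (Fin d → ℝ) :=
  (M.hardLaw (M.target m) (M.q' (M.target m))).map M.g

instance (M : CoupledModel n d) (m : Fin n) : IsProbabilityMeasure (M.obsLaw m) :=
  haveI := M.isProbabilityMeasure_hardLaw (M.target m) (M.q_pdf (M.target m))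
  Measure.isProbabilityMeasure_map M.g_decoder.contDiff.continuous.measurable.aemeasurable

instance (M : CoupledModel n d) (m : Fin n) : IsProbabilityMeasure (M.obsLaw' m) :=
  haveI := M.isProbabilityMeasure_hardLaw (M.target m) (M.q'_pdf (M.target m))
  Measure.isProbabilityMeasure_map M.g_decoder.contDiff.continuous.measurable.aemeasurable

/-- `h` recovers the latent variables up to the permutation `π` and coordinatewise
diffeomorphisms of the real line (of class `C^1`, like the decoder). -/
def RecoversVia (M : CoupledModel n d) (h : (Fin d → ℝ) → (Fin n → ℝ))
    (π : Equiv.Perm (Fin n)) : Prop :=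
  ∃ φ : Fin n → Diffeomorph 𝓘(ℝ, ℝ) 𝓘(ℝ, ℝ) ℝ ℝ 1, ∀ z m, h (M.g z) m = φ m (z (π m))

/-- Componentwise latent recovery. -/
def Recovers (M : CoupledModel n d) (h : (Fin d → ℝ) → (Fin n → ℝ)) : Prop :=
  ∃ π, M.RecoversVia h π

end CoupledModel

/-! ### Graph recovery by adaptive conditional independence tests -/

/-- One conditional independence test, of the coordinates `i` and `j` given those in `S`, in the
environment number `env` of the first (`second = false`) or second (`second = true`) kind. -/
structure CITest (n : ℕ) where
  second : Bool
  env : Fin n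
  i : Fin n
  j : Fin n
  S : Finset (Fin n)

/-- The outcome of a test on the encoded data `h(X)`, where `P m` and `P' m` are the laws of the
observations `X` in the first and second environments: `True` stands for independence. -/
def CITest.Holds {n d : ℕ} (P P' : Fin n → Measure (Fin d → ℝ))
    [∀ m, IsFiniteMeasure (P m)] [∀ m, IsFiniteMeasure (P' m)]
    (h : (Fin d → ℝ) → (Fin n → ℝ)) (t : CITest n) : Prop :=
  match t.second with
  | false => CondIndepCoord ((P t.env).map h) t.i t.j t.S
  | true => CondIndepCoord ((P' t.env).map h) t.i t.j t.S

/-- An adaptive procedure that performs conditional independence tests one after the other, each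
choice depending on the previous outcomes, and finally outputs a graph. -/
inductive CIProcedure (n : ℕ) where
  | output (G : Digraph (Fin n)) : CIProcedure n
  | test (t : CITest n) (ifIndep ifDep : CIProcedure n) : CIProcedure n

namespace CIProcedure

variable {n : ℕ}

/-- The number of tests performed in the worst case. -/
def numTests : CIProcedure n → ℕ
  | output _ => 0
  | test _ a b => max a.numTests b.numTests + 1

open Classical in
/-- The graph that the procedure outputs when the outcomes of the tests are given by `o`. -/
noncomputable def run (o : CITest n → Prop) : CIProcedure n → Digraph (Fin n)
  | output G => G
  | test t a b => if o t then a.run o else b.run o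

end CIProcedure

/-- The pattern of the score differences of the encoded data between the first environment
number `a` and the second environment number `b`, for all `a` and `b`. -/
def scoreTable {n d : ℕ} (P P' : Fin n → Measure (Fin d → ℝ))
    (h : (Fin d → ℝ) → (Fin n → ℝ)) (a b k : Fin n) : Prop :=
  ScoreDiffers ((P a).map h) ((P' b).map h) k

/-! Recovery. For a valid encoder `h`, the map `h ∘ g` is a `C^1` diffeomorphism of latent space
with inverse `χ`. The two environments of a pair differ only in the mechanism of one node `l`, so
their latent log-ratio is `log q_l(z_l) - log q'_l(z_l)`, and in encoded coordinates this function
is composed with `χ_l`. Score differences vanish in coordinate `k` exactly when that composite is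
free of `y_k` (`scoreDiffers_map_iff`). By interventional discrepancy and the intermediate value
theorem, this holds exactly when `χ_l` itself is free of `y_k` (`dependsOn_of_dependsOn_log_ratio`).
A diagonal pattern therefore makes `χ` coordinatewise up to the target permutation. Relabelling the
true inverse realizes the pattern, and any choice of such an encoder is an estimator.

Graph. For targets `i ≠ j`, the score difference sees a third node `l` exactly when `l` is a parent
of `i` or of `j` (`dependsOn_logRatio_iff`): a cancellation between the two mechanisms would force
both `i → j` and `j → i`. These disjunctions determine the children of every node that has two
non-children among the other nodes. By acyclicity at most two nodes remain ambiguous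
(`Represents.card_ambiguous_le`), so testing every pair that starts at one of them costs at most
`2(n-1)` tests.

Each test takes place under an intervention on the source `k`, which cuts the edges into `k`. The
conditioning set, together with `k`, contains all parents of `x` and no descendant of `x` in the cut
graph, so by the local Markov property the test asks whether the mechanism of `x` involves `z_k`
(`condIndepCoord_law_iff`, `condIndepCoord_hardLaw_iff`). Adjacency-faithfulness identifies this
with the edge `k → x`. -/

/-! ### Functions that do not depend on some coordinates -/

section DependsOn

variable {n : ℕ} {β : Type*}

theorem dependsOn_compl_singleton_iff {F : (Fin n → ℝ) → β} {k : Fin n} :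
    DependsOn F {k}ᶜ ↔ ∀ z t, F (Function.update z k t) = F z := by
  constructor
  · intro h z t
    exact h fun i hi => Function.update_of_ne hi _ _
  · intro h x y hxy
    rw [← h x (y k)]
    congr 1
    funext i
    by_cases hi : i = k
    · subst hi; simp
    · rw [Function.update_of_ne hi]; exact hxy i hi

theorem DependsOn.inter {F : (Fin n → ℝ) → β} {s t : Set (Fin n)} (hs : DependsOn F s)
    (ht : DependsOn F t) : DependsOn F (s ∩ t) := by
  classical
  intro x y hxy
  -- The hybrid point agrees with `x` on `s`, and with `y` both off `s` and on `s ∩ t`.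
  have h1 : F x = F (s.piecewise x y) := hs fun i hi => by simp [hi]
  rw [h1]
  refine ht fun i hi => ?_
  by_cases his : i ∈ s
  · simp [his, hxy i ⟨his, hi⟩]
  · simp [his]

theorem dependsOn_compl_finset {F : (Fin n → ℝ) → β} {T : Finset (Fin n)}
    (h : ∀ k ∈ T, DependsOn F {k}ᶜ) : DependsOn F (T : Set (Fin n))ᶜ := by
  induction T using Finset.induction_on with
  | empty => simpa using dependsOn_univ F
  | insert a T _ ih =>
    rw [Finset.coe_insert, Set.insert_eq, Set.compl_union]
    exact (h a (by simp)).inter (ih fun k hk => h k (by simp [hk]))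

theorem dependsOn_singleton_of_forall_ne {F : (Fin n → ℝ) → β} {m : Fin n}
    (h : ∀ k, k ≠ m → DependsOn F {k}ᶜ) : DependsOn F {m} := by
  have h1 := dependsOn_compl_finset (F := F) (T := Finset.univ.erase m)
    fun k hk => h k (Finset.ne_of_mem_erase hk)
  refine h1.mono fun i hi => ?_
  simpa using hi

theorem fderiv_single_eq_zero_iff_dependsOn {F : (Fin n → ℝ) → ℝ} (hF : Differentiable ℝ F)
    (k : Fin n) : (∀ y, fderiv ℝ F y (Pi.single k 1) = 0) ↔ DependsOn F {k}ᶜ := by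
  have hd : ∀ y t, HasDerivAt (fun t => F (Function.update y k t))
      (fderiv ℝ F (Function.update y k t) (Pi.single k 1)) t := fun y t =>
    (hF _).hasFDerivAt.comp_hasDerivAt t (hasDerivAt_update y k t)
  rw [dependsOn_compl_singleton_iff]
  constructor
  · intro h y t
    have := is_const_of_deriv_eq_zero (f := fun t => F (Function.update y k t))
      (fun t => (hd y t).differentiableAt) (fun t => by rw [(hd y t).deriv, h]) t (y k)
    simpa using this
  · intro h y
    have h1 := hd y (y k)
    simp only [h, Function.update_eq_self] at h1
    exact h1.unique (hasDerivAt_const _ _)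

end DependsOn

/-! ### Score differences after a diffeomorphism -/

section Score

variable {n : ℕ}

theorem isOpenPosMeasure_map_of_absolutelyContinuous {ν : Measure (Fin n → ℝ)}
    (hν : volume ≪ ν) {Ψ : (Fin n → ℝ) → (Fin n → ℝ)} (hΨ : Continuous Ψ)
    (hs : Function.Surjective Ψ) : (ν.map Ψ).IsOpenPosMeasure :=
  have := hν.isOpenPosMeasure
  hΨ.isOpenPosMeasure_map hs

/-- Both laws are pushed along the same map, so the Jacobians cancel and no second derivative of the
map is needed. -/
theorem IsLogRatio.map {μ ν : Measure (Fin n → ℝ)} {r : (Fin n → ℝ) → ℝ}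
    (h : IsLogRatio μ ν r) {Ψ χ : (Fin n → ℝ) → (Fin n → ℝ)} (hΨ : Continuous Ψ)
    (hχ : ContDiff ℝ 1 χ) (hl : Function.LeftInverse χ Ψ) :
    IsLogRatio (μ.map Ψ) (ν.map Ψ) (r ∘ χ) := by
  refine ⟨h.1.comp hχ, ?_⟩
  have hm : Measurable fun z => ENNReal.ofReal (Real.exp ((r ∘ χ) z)) :=
    (Real.continuous_exp.comp (h.1.continuous.comp hχ.continuous)).measurable.ennreal_ofReal
  ext s hs
  rw [Measure.map_apply hΨ.measurable hs, withDensity_apply _ hs,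
    setLIntegral_map hs hm hΨ.measurable, h.2, withDensity_apply _ (hΨ.measurable hs)]
  simp only [Function.comp, hl _]

/-- Densities agree almost everywhere, and continuous functions that agree `ν`-a.e. are equal when
`ν` charges open sets. Hence the existential in `ScoreDiffers` involves no choice. -/
theorem IsLogRatio.unique {μ ν : Measure (Fin n → ℝ)} [SigmaFinite ν] [ν.IsOpenPosMeasure]
    {r r' : (Fin n → ℝ) → ℝ} (h : IsLogRatio μ ν r) (h' : IsLogRatio μ ν r') : r = r' := by
  have hm : ∀ r : (Fin n → ℝ) → ℝ, ContDiff ℝ 1 r →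
      Measurable fun z => ENNReal.ofReal (Real.exp (r z)) := fun r hr =>
    (Real.continuous_exp.comp hr.continuous).measurable.ennreal_ofReal
  have h1 := h.2.symm.trans h'.2
  rw [withDensity_eq_iff_of_sigmaFinite (hm r h.1).aemeasurable (hm r' h'.1).aemeasurable] at h1
  refine (Continuous.ae_eq_iff_eq ν h.1.continuous h'.1.continuous).1 ?_
  filter_upwards [h1] with z hz
  rw [ENNReal.ofReal_eq_ofReal_iff (Real.exp_pos _).le (Real.exp_pos _).le] at hz
  exact Real.exp_injective hz

/-- A continuous partial derivative with zero expected absolute value vanishes everywhere. From here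
on scores enter only through `DependsOn`. -/
theorem scoreDiffers_iff {μ ν : Measure (Fin n → ℝ)} [SigmaFinite ν] [ν.IsOpenPosMeasure]
    {r : (Fin n → ℝ) → ℝ} (h : IsLogRatio μ ν r) (k : Fin n) :
    ScoreDiffers μ ν k ↔ ¬ DependsOn r {k}ᶜ := by
  have hc : Continuous fun z => fderiv ℝ r z (Pi.single k 1) :=
    (h.1.continuous_fderiv one_ne_zero).clm_apply continuous_const
  have key : ∫⁻ z, ‖fderiv ℝ r z (Pi.single k 1)‖ₑ ∂ν = 0 ↔ DependsOn r {k}ᶜ := by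
    rw [← fderiv_single_eq_zero_iff_dependsOn (h.1.differentiable one_ne_zero),
      lintegral_eq_zero_iff hc.measurable.enorm]
    constructor
    · intro h0
      have : (fun z => fderiv ℝ r z (Pi.single k 1)) =ᵐ[ν] fun _ => 0 := by
        filter_upwards [h0] with z hz
        simpa using hz
      exact fun y => congrFun ((Continuous.ae_eq_iff_eq ν hc continuous_const).1 this) y
    · intro h0
      exact Filter.Eventually.of_forall fun z => by simp [h0]
  constructor
  · rintro ⟨r', hr', h0⟩
    rw [h.unique hr', ← key.not, h.unique hr'] at *
    exact h0
  · intro h0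
    exact ⟨r, h, key.not.2 h0⟩

theorem scoreDiffers_map_iff {μ ν : Measure (Fin n → ℝ)} [IsFiniteMeasure ν] (hν : volume ≪ ν)
    {r : (Fin n → ℝ) → ℝ} (h : IsLogRatio μ ν r) {Ψ χ : (Fin n → ℝ) → (Fin n → ℝ)}
    (hΨ : Continuous Ψ) (hχ : ContDiff ℝ 1 χ) (hl : Function.LeftInverse χ Ψ)
    (hr : Function.RightInverse χ Ψ) (k : Fin n) :
    ScoreDiffers (μ.map Ψ) (ν.map Ψ) k ↔ ¬ DependsOn (r ∘ χ) {k}ᶜ := by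
  have := isOpenPosMeasure_map_of_absolutelyContinuous hν hΨ hr.surjective
  exact scoreDiffers_iff (h.map hΨ hχ hl) k

end Score

/-! ### Transition maps between decoders -/

section Transition

variable {n d : ℕ}

/-- Composing `g₂` with a linear left inverse of its derivative at one point gives a map between
spaces of equal dimension, to which the inverse function theorem applies. Continuity of `h ∘ g`,
from the embedding `g₂`, keeps nearby values inside the domain of the local inverse. -/
theorem IsDecoder.contDiff_transition {g g₂ : (Fin n → ℝ) → (Fin d → ℝ)} (hg : IsDecoder g)
    (hg₂ : IsDecoder g₂) {h : (Fin d → ℝ) → (Fin n → ℝ)} (hh : ∀ y, h (g₂ y) = y)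
    (hr : Set.range g ⊆ Set.range g₂) : ContDiff ℝ 1 (fun z => h (g z)) := by
  have hinv : ∀ z, g₂ (h (g z)) = g z := by
    intro z
    obtain ⟨y, hy⟩ := hr ⟨z, rfl⟩
    rw [← hy, hh]
  have hcont : Continuous fun z => h (g z) := by
    rw [hg₂.isEmbedding.continuous_iff]
    exact hg.contDiff.continuous.congr fun z => (hinv z).symm
  rw [contDiff_iff_contDiffAt]
  intro z₀
  set y₀ := h (g z₀) with hy₀
  obtain ⟨L, hL⟩ := LinearMap.exists_leftInverse_of_injective
    (fderiv ℝ g₂ y₀ : (Fin n → ℝ) →ₗ[ℝ] (Fin d → ℝ))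
    (LinearMap.ker_eq_bot.2 (hg₂.fderiv_injective y₀))
  let L' : (Fin d → ℝ) →L[ℝ] (Fin n → ℝ) := LinearMap.toContinuousLinearMap L
  have hF : ContDiffAt ℝ 1 (fun y => L' (g₂ y)) y₀ :=
    (L'.contDiff.comp hg₂.contDiff).contDiffAt
  have hF' : HasFDerivAt (fun y => L' (g₂ y))
      ((ContinuousLinearEquiv.refl ℝ (Fin n → ℝ) : (Fin n → ℝ) →L[ℝ] (Fin n → ℝ))) y₀ := by
    have h1 := L'.hasFDerivAt.comp y₀
      (hg₂.contDiff.differentiable one_ne_zero y₀).hasFDerivAt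
    have heq : ((ContinuousLinearEquiv.refl ℝ (Fin n → ℝ) : (Fin n → ℝ) →L[ℝ] (Fin n → ℝ)))
        = L'.comp (fderiv ℝ g₂ y₀) :=
      ContinuousLinearMap.ext fun v => (LinearMap.congr_fun hL v).symm
    rw [heq]
    exact h1
  have hs := hF.hasStrictFDerivAt' hF' one_ne_zero
  have hinvC : ContDiffAt ℝ 1 (hF.localInverse hF' one_ne_zero) (L' (g₂ y₀)) :=
    hF.to_localInverse hF' one_ne_zero
  have hcomp : ContDiffAt ℝ 1 (fun z => hF.localInverse hF' one_ne_zero (L' (g z))) z₀ := by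
    refine ContDiffAt.comp z₀ (g := hF.localInverse hF' one_ne_zero) (f := fun z => L' (g z))
      ?_ (L'.contDiff.comp hg.contDiff).contDiffAt
    rw [← hinv z₀]
    exact hinvC
  refine hcomp.congr_of_eventuallyEq ?_
  have h2 := (hcont.continuousAt (x := z₀)).eventually hs.eventually_left_inverse
  filter_upwards [h2] with z hz
  rw [← hinv z]
  simp only [hh]
  exact hz.symm

theorem IsDecoder.measurableEmbedding {g : (Fin n → ℝ) → (Fin d → ℝ)} (hg : IsDecoder g) :
    MeasurableEmbedding g :=
  hg.contDiff.continuous.measurableEmbedding hg.isEmbedding.injective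

/-- The encoder is controlled only on the image of `g`, which suffices for a.e. measurability under
the pushed-forward law. -/
theorem IsDecoder.map_map {g : (Fin n → ℝ) → (Fin d → ℝ)} (hg : IsDecoder g)
    {h : (Fin d → ℝ) → (Fin n → ℝ)} (hh : Measurable fun z => h (g z))
    (μ : Measure (Fin n → ℝ)) : (μ.map g).map h = μ.map fun z => h (g z) := by
  have h1 : AEMeasurable h (μ.map g) :=
    (hg.measurableEmbedding.aemeasurable_map_iff).2 hh.aemeasurable
  exact AEMeasurable.map_map_of_aemeasurable h1 hg.contDiff.continuous.measurable.aemeasurable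

end Transition

/-! ### Coordinatewise diffeomorphisms -/

section Coordinatewise

variable {n : ℕ}

theorem contDiff_update_const (y : Fin n → ℝ) (k : Fin n) :
    ContDiff ℝ 1 (fun t => Function.update y k t) := by
  rw [contDiff_pi]
  intro i
  by_cases hi : i = k
  · subst hi; simpa using contDiff_fun_id
  · simpa [hi] using contDiff_const

theorem exists_diffeomorph_of_dependsOn {Ψ χ : (Fin n → ℝ) → (Fin n → ℝ)}
    (hΨ : ContDiff ℝ 1 Ψ) (hχ : ContDiff ℝ 1 χ) (hl : Function.LeftInverse χ Ψ)
    (hr : Function.RightInverse χ Ψ) (τ : Equiv.Perm (Fin n))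
    (hdep : ∀ m, DependsOn (fun y => χ y (τ m)) {m}) :
    ∃ φ : Fin n → Diffeomorph 𝓘(ℝ, ℝ) 𝓘(ℝ, ℝ) ℝ ℝ 1, ∀ z m, Ψ z m = φ m (z (τ m)) := by
  let c : Fin n → ℝ → ℝ := fun m u => χ (Function.update 0 m u) (τ m)
  let f : Fin n → ℝ → ℝ := fun m t => Ψ (Function.update 0 (τ m) t) m
  have hc : ∀ y m, χ y (τ m) = c m (y m) := fun y m => hdep m fun i hi => by
    rw [Set.mem_singleton_iff] at hi
    subst hi; simp
  have hz : ∀ z m, z (τ m) = c m (Ψ z m) := fun z m => by rw [← hc, hl]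
  -- Varying coordinate `m` alone changes only component `τ m` of `χ`, so a collision of `c m` would
  -- be a collision of `χ`.
  have hinj : ∀ m, Function.Injective (c m) := by
    intro m u v huv
    have h1 : χ (Function.update 0 m u) = χ (Function.update 0 m v) := by
      funext i
      obtain ⟨m', rfl⟩ := τ.surjective i
      rw [hc, hc]
      by_cases hm : m' = m
      · subst hm; simpa using huv
      · simp [hm]
    have h2 := congrFun (hr.injective h1) m
    simpa using h2
  have hcf : ∀ m t, c m (f m t) = t := fun m t => by
    rw [← hz]; simp
  have hfc : ∀ m u, f m (c m u) = u := fun m u => hinj m (hcf m _)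
  refine ⟨fun m => ⟨⟨f m, c m, hcf m, hfc m⟩, ?_, ?_⟩, fun z m => hinj m ?_⟩
  · exact ((contDiff_pi.1 (hΨ.comp (contDiff_update_const 0 (τ m)))) m).contMDiff
  · exact ((contDiff_pi.1 (hχ.comp (contDiff_update_const 0 m))) (τ m)).contMDiff
  · rw [← hz]
    exact (hcf m _).symm

/-- If `H` took two values along a line in direction `k`, it would sweep the interval between them.
There `q / q'` would be constant, so its derivative would vanish on a set of positive measure. -/
theorem dependsOn_of_dependsOn_log_ratio {q q' : ℝ → ℝ} (hq : IsPosPdf q) (hq' : IsPosPdf q')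
    (hd : InterventionalDiscrepancy q q') {H : (Fin n → ℝ) → ℝ} (hH : Continuous H) {k : Fin n}
    (h : DependsOn (fun y => Real.log (q (H y)) - Real.log (q' (H y))) {k}ᶜ) :
    DependsOn H {k}ᶜ := by
  rw [dependsOn_compl_singleton_iff] at h ⊢
  intro y t
  by_contra hne
  have hR : ∀ s, q (H (Function.update y k s)) / q' (H (Function.update y k s))
      = q (H y) / q' (H y) := by
    intro s
    have h1 := h y s
    rw [← Real.log_div (hq.pos _).ne' (hq'.pos _).ne',
      ← Real.log_div (hq.pos _).ne' (hq'.pos _).ne'] at h1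
    exact Real.log_injOn_pos (div_pos (hq.pos _) (hq'.pos _)) (div_pos (hq.pos _) (hq'.pos _)) h1
  have hcont : Continuous fun s => H (Function.update y k s) :=
    hH.comp (contDiff_update_const y k).continuous
  have hsub := intermediate_value_uIcc (hcont.continuousOn (s := Set.uIcc t (y k)))
  simp only [Function.update_eq_self] at hsub
  have hzero : ∀ u ∈ Set.Ioo (min (H (Function.update y k t)) (H y))
      (max (H (Function.update y k t)) (H y)), deriv (fun v => q v / q' v) u = 0 := by
    intro u hu
    have : (fun v => q v / q' v) =ᶠ[nhds u] fun _ => q (H y) / q' (H y) := by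
      filter_upwards [Ioo_mem_nhds hu.1 hu.2] with v hv
      obtain ⟨s, -, rfl⟩ := hsub (Set.Ioo_subset_Icc_self hv)
      exact hR s
    rw [this.deriv_eq, deriv_const]
  have hpos : 0 < volume (Set.Ioo (min (H (Function.update y k t)) (H y))
      (max (H (Function.update y k t)) (H y))) := by
    rw [Real.volume_Ioo, ENNReal.ofReal_pos, sub_pos, min_lt_max]
    exact hne
  refine hpos.ne' (measure_mono_null (fun u hu => ?_) hd)
  simpa using hzero u hu

end Coordinatewise

/-! ### Hard interventions -/

section Density

variable {n : ℕ}

theorem volume_absolutelyContinuous_withDensity {f : (Fin n → ℝ) → ℝ} (hf : Continuous f)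
    (hpos : ∀ z, 0 < f z) :
    volume ≪ (volume : Measure (Fin n → ℝ)).withDensity (fun z => ENNReal.ofReal (f z)) :=
  withDensity_absolutelyContinuous' hf.measurable.ennreal_ofReal.aemeasurable
    (Filter.Eventually.of_forall fun z => by simpa using hpos z)

theorem isLogRatio_withDensity {f₁ f₂ : (Fin n → ℝ) → ℝ} (h₁ : ContDiff ℝ 1 f₁)
    (h₂ : ContDiff ℝ 1 f₂) (p₁ : ∀ z, 0 < f₁ z) (p₂ : ∀ z, 0 < f₂ z) :
    IsLogRatio (volume.withDensity fun z => ENNReal.ofReal (f₁ z))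
      (volume.withDensity fun z => ENNReal.ofReal (f₂ z))
      (fun z => Real.log (f₁ z) - Real.log (f₂ z)) := by
  have hr : ContDiff ℝ 1 fun z => Real.log (f₁ z) - Real.log (f₂ z) :=
    (h₁.log fun z => (p₁ z).ne').sub (h₂.log fun z => (p₂ z).ne')
  refine ⟨hr, ?_⟩
  have hm : Measurable fun z => ENNReal.ofReal (Real.exp (Real.log (f₁ z) - Real.log (f₂ z))) :=
    (Real.continuous_exp.comp hr.continuous).measurable.ennreal_ofReal
  rw [← withDensity_mul _ h₂.continuous.measurable.ennreal_ofReal hm]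
  congr 1
  funext z
  rw [Pi.mul_apply, ← ENNReal.ofReal_mul (p₂ z).le, Real.exp_sub, Real.exp_log (p₁ z),
    Real.exp_log (p₂ z), mul_div_cancel₀ _ (p₂ z).ne']

end Density

namespace CausalModel

variable {n : ℕ} (M : CausalModel n)

theorem density_pos (z : Fin n → ℝ) : 0 < M.density z :=
  Finset.prod_pos fun i _ => M.mech_pos i z

theorem density_contDiff : ContDiff ℝ 1 M.density :=
  contDiff_prod fun i _ => M.mech_contDiff i

/-- The causal model after a hard intervention on node `l` with the new mechanism `q`: the edges
into `l` are removed. -/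
def hardIntervention (l : Fin n) {q : ℝ → ℝ} (hq : IsPosPdf q) : CausalModel n where
  graph := ⟨fun j i => M.graph.Adj j i ∧ i ≠ l⟩
  acyclic i h := M.acyclic i (Relation.TransGen.mono (fun _ _ h' => h'.1) i i h)
  mech := Function.update M.mech l fun z => q (z l)
  mech_local i z w hi hpa := by
    by_cases h : i = l
    · subst h; simp [hi]
    · simp only [Function.update_of_ne h]
      exact M.mech_local i z w hi fun j hj => hpa j ⟨hj, h⟩
  mech_pos i z := by
    by_cases h : i = l
    · subst h; simpa using hq.pos _
    · simpa [h] using M.mech_pos i z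
  mech_contDiff i := by
    by_cases h : i = l
    · subst h; simpa [Function.comp_def] using hq.contDiff.comp (contDiff_apply ℝ ℝ i)
    · simpa [h] using M.mech_contDiff i
  mech_lintegral i z := by
    by_cases h : i = l
    · subst h; simpa using hq.lintegral_eq_one
    · simpa [h] using M.mech_lintegral i z

theorem hardIntervention_density (l : Fin n) {q : ℝ → ℝ} (hq : IsPosPdf q) :
    (M.hardIntervention l hq).density = M.hardDensity l q := by
  funext z
  rw [density, hardDensity, ← Finset.mul_prod_erase _ _ (Finset.mem_univ l)]
  simp only [hardIntervention, Function.update_self]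
  congr 1
  refine Finset.prod_congr rfl fun i hi => ?_
  rw [Function.update_of_ne (Finset.ne_of_mem_erase hi)]

theorem hardIntervention_law (l : Fin n) {q : ℝ → ℝ} (hq : IsPosPdf q) :
    (M.hardIntervention l hq).law = M.hardLaw l q := by
  rw [law, hardLaw, hardIntervention_density]

/-- Written relative to the observational density, which cancels between any two interventions. -/
theorem log_hardDensity (l : Fin n) {q : ℝ → ℝ} (hq : IsPosPdf q) (z : Fin n → ℝ) :
    Real.log (M.hardDensity l q z)
      = Real.log (q (z l)) - Real.log (M.mech l z) + Real.log (M.density z) := by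
  have h1 : M.density z = M.mech l z * ∏ i ∈ Finset.univ.erase l, M.mech i z :=
    (Finset.mul_prod_erase _ _ (Finset.mem_univ l)).symm
  have h2 : 0 < ∏ i ∈ Finset.univ.erase l, M.mech i z :=
    Finset.prod_pos fun i _ => M.mech_pos i z
  rw [h1, hardDensity, Real.log_mul (hq.pos _).ne' h2.ne',
    Real.log_mul (M.mech_pos l z).ne' h2.ne']
  ring

theorem volume_absolutelyContinuous_law : volume ≪ M.law :=
  volume_absolutelyContinuous_withDensity M.density_contDiff.continuous M.density_pos

theorem volume_absolutelyContinuous_hardLaw (l : Fin n) {q : ℝ → ℝ} (hq : IsPosPdf q) :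
    volume ≪ M.hardLaw l q := by
  rw [← M.hardIntervention_law l hq]
  exact (M.hardIntervention l hq).volume_absolutelyContinuous_law

theorem isLogRatio_hardLaw (i j : Fin n) {q q' : ℝ → ℝ} (hq : IsPosPdf q) (hq' : IsPosPdf q') :
    IsLogRatio (M.hardLaw i q) (M.hardLaw j q') (fun z =>
      (Real.log (q (z i)) - Real.log (M.mech i z))
        - (Real.log (q' (z j)) - Real.log (M.mech j z))) := by
  have h := isLogRatio_withDensity (M.hardIntervention i hq).density_contDiff
    (M.hardIntervention j hq').density_contDiff (M.hardIntervention i hq).density_pos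
    (M.hardIntervention j hq').density_pos
  simp only [hardIntervention_density, M.log_hardDensity i hq, M.log_hardDensity j hq',
    add_sub_add_right_eq_sub] at h
  exact h

theorem isLogRatio_hardLaw_self (l : Fin n) {q q' : ℝ → ℝ} (hq : IsPosPdf q)
    (hq' : IsPosPdf q') : IsLogRatio (M.hardLaw l q) (M.hardLaw l q') (fun z =>
      Real.log (q (z l)) - Real.log (q' (z l))) := by
  have h := M.isLogRatio_hardLaw l l hq hq'
  simp only [sub_sub_sub_cancel_right] at h
  exact h

end CausalModel

/-! ### Recovery of the latent variables -/

namespace CoupledModel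

variable {n d : ℕ} (M : CoupledModel n d)

theorem obsLaw_map {h : (Fin d → ℝ) → (Fin n → ℝ)} (hh : Measurable fun z => h (M.g z))
    (m : Fin n) : (M.obsLaw m).map h
      = (M.hardLaw (M.target m) (M.q (M.target m))).map fun z => h (M.g z) :=
  M.g_decoder.map_map hh _

theorem obsLaw'_map {h : (Fin d → ℝ) → (Fin n → ℝ)} (hh : Measurable fun z => h (M.g z))
    (m : Fin n) : (M.obsLaw' m).map h
      = (M.hardLaw (M.target m) (M.q' (M.target m))).map fun z => h (M.g z) :=
  M.g_decoder.map_map hh _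

/-- For data encoded by `h`, the scores in the first environment number `a` and the second
environment number `b` differ in coordinate `k` if and only if the log-ratio of the latent laws,
expressed in the encoded coordinates, depends on coordinate `k`. -/
theorem scoreTable_iff {h : (Fin d → ℝ) → (Fin n → ℝ)} {χ : (Fin n → ℝ) → (Fin n → ℝ)}
    (hΨ : Continuous fun z => h (M.g z)) (hχ : ContDiff ℝ 1 χ)
    (hl : Function.LeftInverse χ fun z => h (M.g z))
    (hr : Function.RightInverse χ fun z => h (M.g z)) (a b k : Fin n) {r : (Fin n → ℝ) → ℝ}
    (hlog : IsLogRatio (M.hardLaw (M.target a) (M.q (M.target a)))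
      (M.hardLaw (M.target b) (M.q' (M.target b))) r) :
    scoreTable M.obsLaw M.obsLaw' h a b k ↔ ¬ DependsOn (r ∘ χ) {k}ᶜ := by
  have := M.isProbabilityMeasure_hardLaw (M.target b) (M.q'_pdf (M.target b))
  rw [scoreTable, M.obsLaw_map hΨ.measurable, M.obsLaw'_map hΨ.measurable]
  exact scoreDiffers_map_iff
    (M.volume_absolutelyContinuous_hardLaw _ (M.q'_pdf _)) hlog hΨ hχ hl hr k

theorem scoreTable_self_iff (hd : ∀ i, InterventionalDiscrepancy (M.q i) (M.q' i))
    {h : (Fin d → ℝ) → (Fin n → ℝ)} {χ : (Fin n → ℝ) → (Fin n → ℝ)}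
    (hΨ : Continuous fun z => h (M.g z)) (hχ : ContDiff ℝ 1 χ)
    (hl : Function.LeftInverse χ fun z => h (M.g z))
    (hr : Function.RightInverse χ fun z => h (M.g z)) (m k : Fin n) :
    scoreTable M.obsLaw M.obsLaw' h m m k ↔ ¬ DependsOn (fun y => χ y (M.target m)) {k}ᶜ := by
  rw [M.scoreTable_iff hΨ hχ hl hr m m k
    (M.isLogRatio_hardLaw_self _ (M.q_pdf _) (M.q'_pdf _)), not_iff_not]
  constructor
  · exact fun h1 => dependsOn_of_dependsOn_log_ratio (M.q_pdf _) (M.q'_pdf _) (hd _)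
      (contDiff_pi.1 hχ _).continuous h1
  · intro h1 y w hyw
    have h2 : χ y (M.target m) = χ w (M.target m) := h1 hyw
    simp only [Function.comp, h2]

theorem exists_transition_of_isValidEncoder {h : (Fin d → ℝ) → (Fin n → ℝ)}
    (hh : IsValidEncoder M.manifold h) : ∃ χ : (Fin n → ℝ) → (Fin n → ℝ),
      ContDiff ℝ 1 (fun z => h (M.g z)) ∧ ContDiff ℝ 1 χ ∧
      Function.LeftInverse χ (fun z => h (M.g z)) ∧
      Function.RightInverse χ (fun z => h (M.g z)) := by
  obtain ⟨g₂, hg₂, hrange, hinv⟩ := hh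
  have hr : ∀ z, g₂ (h (M.g z)) = M.g z := by
    intro z
    obtain ⟨y, hy⟩ : M.g z ∈ Set.range g₂ := hrange ▸ ⟨z, rfl⟩
    rw [← hy, hinv]
  have hl : ∀ z, Function.invFun M.g (M.g z) = z :=
    Function.leftInverse_invFun M.g_decoder.isEmbedding.injective
  refine ⟨fun y => Function.invFun M.g (g₂ y),
    M.g_decoder.contDiff_transition hg₂ hinv hrange.ge,
    hg₂.contDiff_transition M.g_decoder hl hrange.le, fun z => ?_, fun y => ?_⟩
  · simp only [hr, hl]
  · obtain ⟨z, hz⟩ : g₂ y ∈ Set.range M.g := hrange.le ⟨y, rfl⟩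
    simp only [← hz, hl]
    rw [hz, hinv]

theorem recovers_of_isScoreEncoder (hd : ∀ i, InterventionalDiscrepancy (M.q i) (M.q' i))
    {h : (Fin d → ℝ) → (Fin n → ℝ)} (hh : IsScoreEncoder M.manifold M.obsLaw M.obsLaw' h) :
    M.Recovers h := by
  obtain ⟨χ, hΨ, hχ, hl, hr⟩ := M.exists_transition_of_isValidEncoder hh.1
  refine ⟨M.target, exists_diffeomorph_of_dependsOn hΨ hχ hl hr M.target fun m =>
    -- The off-diagonal zeros in row `m` leave `y_m` as the only coordinate on which `χ_{target m}`
    -- can depend.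
    dependsOn_singleton_of_forall_ne fun k hk => ?_⟩
  by_contra hdep
  exact hk ((hh.2 m k).1 ((M.scoreTable_self_iff hd hΨ.continuous hχ hl hr m k).2 hdep))

theorem exists_isScoreEncoder (hd : ∀ i, InterventionalDiscrepancy (M.q i) (M.q' i)) :
    ∃ h, IsScoreEncoder M.manifold M.obsLaw M.obsLaw' h := by
  -- The witness is the true inverse of `g`, with coordinates relabelled so that coordinate `m` is
  -- the node targeted in environment `m`.
  let e : (Fin n → ℝ) ≃L[ℝ] (Fin n → ℝ) :=
    ContinuousLinearEquiv.piCongrLeft ℝ (fun _ : Fin n => ℝ) M.target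
  have he : ∀ y m, e y (M.target m) = y m := fun y m =>
    Equiv.piCongrLeft_apply_apply (fun _ : Fin n => ℝ) M.target y m
  have hdec : IsDecoder fun y => M.g (e y) := by
    refine ⟨M.g_decoder.contDiff.comp e.contDiff,
      M.g_decoder.isEmbedding.comp e.toHomeomorph.isEmbedding, fun z => ?_⟩
    have h1 := (M.g_decoder.contDiff.differentiable one_ne_zero (e z)).hasFDerivAt.comp z
      e.hasFDerivAt
    have h2 : fderiv ℝ (fun y => M.g (e y)) z = (fderiv ℝ M.g (e z)).comp e.toContinuousLinearMap :=
      h1.fderiv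
    rw [h2]
    exact (M.g_decoder.fderiv_injective _).comp e.injective
  have hl : ∀ z, Function.invFun M.g (M.g z) = z :=
    Function.leftInverse_invFun M.g_decoder.isEmbedding.injective
  let h : (Fin d → ℝ) → (Fin n → ℝ) := fun x => e.symm (Function.invFun M.g x)
  have hh : ∀ z, h (M.g z) = e.symm z := fun z => by simp only [h, hl]
  have hhf : (fun z => h (M.g z)) = e.symm := funext hh
  refine ⟨h, ⟨_, hdec, ?_, fun y => by simp [hh]⟩, fun m k => ?_⟩
  · exact e.surjective.range_comp M.g
  · have h1 := M.scoreTable_self_iff hd (h := h) (χ := e) (by rw [hhf]; exact e.symm.continuous)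
      e.contDiff (fun z => by simp [hh]) (fun z => by simp [hh]) m k
    rw [scoreTable] at h1
    rw [h1]
    simp only [he]
    rw [dependsOn_compl_singleton_iff]
    constructor
    · intro h2
      by_contra hk
      exact h2 fun z t => Function.update_of_ne (Ne.symm hk) _ _
    · rintro rfl h2
      have h3 := h2 0 1
      simp at h3

end CoupledModel

/-! ### Marginalization in a causal model -/

section CoordSigma

variable {n : ℕ}

theorem coordSigma_mono {S T : Finset (Fin n)} (h : S ⊆ T) : coordSigma S ≤ coordSigma T :=
  iSup₂_le fun k hk => le_iSup₂_of_le k (h hk) le_rfl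

theorem coordSigma_insert (k : Fin n) (S : Finset (Fin n)) :
    coordSigma (insert k S)
      = MeasurableSpace.comap (fun z : Fin n → ℝ => z k) inferInstance ⊔ coordSigma S := by
  simp only [coordSigma, Finset.iSup_insert]

theorem dependsOn_mem_of_measurableSet {S : Finset (Fin n)} {A : Set (Fin n → ℝ)}
    (hA : MeasurableSet[coordSigma S] A) : DependsOn (fun z => z ∈ A) (S : Set (Fin n)) := by
  -- The sets determined by the coordinates in `S` form a σ-algebra containing the generators.
  let m : MeasurableSpace (Fin n → ℝ) :=
    { MeasurableSet' := fun A => DependsOn (fun z => z ∈ A) (S : Set (Fin n))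
      measurableSet_empty := by
        intro z w _
        rfl
      measurableSet_compl := by
        intro B hB z w h
        exact congrArg Not (hB h)
      measurableSet_iUnion := by
        intro B hB z w h
        simp only [Set.mem_iUnion]
        exact congrArg _ (funext fun i => hB i h) }
  have hle : coordSigma S ≤ m := by
    refine iSup₂_le fun k hk => ?_
    rintro _ ⟨s, -, rfl⟩ z w h
    have hk' := h k hk
    simp only [Set.mem_preimage, hk']
  exact hle A hA

theorem dependsOn_of_measurable_coordSigma {S : Finset (Fin n)} {F : (Fin n → ℝ) → ℝ}
    (hF : Measurable[coordSigma S] F) : DependsOn F (S : Set (Fin n)) := by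
  intro z w h
  have h1 := dependsOn_mem_of_measurableSet (hF (measurableSet_singleton (F w))) h
  simpa using h1

theorem measurable_coordSigma_of_dependsOn {β : Type*} [MeasurableSpace β] {S : Finset (Fin n)}
    {F : (Fin n → ℝ) → β} (hF : Measurable F) (hd : DependsOn F (S : Set (Fin n))) :
    Measurable[coordSigma S] F := by
  -- Zeroing the coordinates outside `S` is `coordSigma S`-measurable and does not change `F`.
  have h1 : F = F ∘ fun z i => if i ∈ S then z i else 0 := by
    funext z
    refine hd fun i hi => ?_
    rw [Finset.mem_coe] at hi
    simp [hi]
  rw [h1]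
  refine hF.comp ?_
  refine @measurable_pi_lambda _ _ _ (coordSigma S) _ _ fun i => ?_
  by_cases hi : i ∈ S
  · simp only [hi, if_true]
    exact (comap_measurable fun z : Fin n → ℝ => z i).mono
      (le_iSup₂_of_le (f := fun k (_ : k ∈ S) => MeasurableSpace.comap
        (fun z : Fin n → ℝ => z k) inferInstance) i hi le_rfl) le_rfl
  · simp only [hi, if_false]
    exact @measurable_const _ _ _ (coordSigma S) _

end CoordSigma

/-! ### Integrating out nodes along the DAG. -/

namespace CausalModel

variable {n : ℕ}

theorem lmarginal_prod_kernels (G : Digraph (Fin n)) (hG : ∀ i, ¬ Relation.TransGen G.Adj i i)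
    (K : Fin n → (Fin n → ℝ) → ENNReal) (hm : ∀ i, Measurable (K i))
    (hloc : ∀ i z w, z i = w i → (∀ j, G.Adj j i → z j = w j) → K i z = K i w)
    (hone : ∀ i z, ∫⁻ t, K i (Function.update z i t) = 1) (T : Finset (Fin n)) :
    ∀ z, lmarginal (fun _ : Fin n => (volume : Measure ℝ)) T (fun z => ∏ i ∈ T, K i z) z = 1 := by
  induction hc : T.card generalizing T with
  | zero =>
    intro z
    rw [Finset.card_eq_zero] at hc
    subst hc
    simp
  | succ c ih =>
    intro z
    have hne : T.Nonempty := by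
      rw [← Finset.card_pos]; omega
    have hwf : WellFounded (fun a b => Relation.TransGen G.Adj b a) := by
      have : IsTrans (Fin n) (fun a b => Relation.TransGen G.Adj b a) :=
        ⟨fun a b c h1 h2 => h2.trans h1⟩
      have : Std.Irrefl (fun a b => Relation.TransGen G.Adj b a) := ⟨fun a h => hG a h⟩
      exact Finite.wellFounded_of_trans_of_irrefl _
    -- A sink of `T`: its coordinate enters no other kernel of `T`, so integrating it out removes
    -- exactly its own factor.
    obtain ⟨i, hiT, hi⟩ := hwf.has_min (T : Set (Fin n)) hne
    have hiT' : i ∈ T := hiT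
    have hsplit : T = insert i (T.erase i) := (Finset.insert_erase hiT').symm
    have hmeas : Measurable (fun z => ∏ k ∈ T, K k z) :=
      Finset.measurable_prod _ (fun k _ => hm k)
    have hfun : (fun x : Fin n → ℝ => ∫⁻ t, ∏ k ∈ T, K k (Function.update x i t))
        = fun x => ∏ k ∈ T.erase i, K k x := by
      funext x
      have h1 : ∀ t, ∏ k ∈ T, K k (Function.update x i t)
          = K i (Function.update x i t) * ∏ k ∈ T.erase i, K k x := by
        intro t
        rw [← Finset.mul_prod_erase T _ hiT']
        congr 1
        refine Finset.prod_congr rfl (fun k hk => ?_)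
        have hki : k ≠ i := Finset.ne_of_mem_erase hk
        refine hloc k _ _ (Function.update_of_ne hki _ _) (fun j hj => ?_)
        refine Function.update_of_ne (fun hji => ?_) _ _
        subst hji
        exact hi k (Finset.mem_of_mem_erase hk) (Relation.TransGen.single hj)
      simp_rw [h1]
      have hmi : Measurable (fun t : ℝ => K i (Function.update x i t)) :=
        (hm i).comp (measurable_update x)
      rw [lintegral_mul_const _ hmi, hone, one_mul]
    have hins := lmarginal_insert' (μ := fun _ : Fin n => (volume : Measure ℝ))
      (fun z => ∏ k ∈ T, K k z) hmeas (Finset.notMem_erase i T)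
    rw [← hsplit] at hins
    rw [hins, hfun]
    exact ih _ (by rw [Finset.card_erase_of_mem hiT', hc]; rfl) z

variable (M : CausalModel n)

/-- The conditional density of node `i`, with values in the extended nonnegative reals. -/
noncomputable def emech (i : Fin n) (z : Fin n → ℝ) : ENNReal := ENNReal.ofReal (M.mech i z)

theorem measurable_emech (i : Fin n) : Measurable (M.emech i) :=
  (M.mech_contDiff i).continuous.measurable.ennreal_ofReal

theorem dependsOn_emech (i : Fin n) : DependsOn (M.emech i) (insert i {j | M.graph.Adj j i}) := by
  intro z w h
  rw [emech, emech, M.mech_local i z w (h i (by simp)) fun j hj => h j (Or.inr hj)]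

theorem lintegral_law {H : (Fin n → ℝ) → ENNReal} (hH : Measurable H) :
    ∫⁻ z, H z ∂M.law = ∫⁻ z, H z * ∏ i, M.emech i z := by
  rw [law, lintegral_withDensity_eq_lintegral_mul _
    M.density_contDiff.continuous.measurable.ennreal_ofReal hH]
  refine lintegral_congr fun z => ?_
  rw [Pi.mul_apply, mul_comm, density, ENNReal.ofReal_prod_of_nonneg fun i _ => (M.mech_pos i z).le]
  rfl

/-- The integral of `H` over `z_x` against the conditional density of `Z_x`. -/
noncomputable def condLIntegral (x : Fin n) (H : (Fin n → ℝ) → ENNReal) (z : Fin n → ℝ) : ENNReal :=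
  ∫⁻ t, H (Function.update z x t) * M.emech x (Function.update z x t)

theorem measurable_condLIntegral (x : Fin n) {H : (Fin n → ℝ) → ENNReal} (hH : Measurable H) :
    Measurable (M.condLIntegral x H) := by
  have h1 : Measurable fun p : (Fin n → ℝ) × ℝ => Function.update p.1 x p.2 := by
    refine measurable_pi_lambda _ fun i => ?_
    by_cases hi : i = x
    · subst hi; simpa using measurable_snd
    · simpa [hi, Function.comp_def] using (measurable_pi_apply i).comp measurable_fst
  exact Measurable.lintegral_prod_right ((hH.mul (M.measurable_emech x)).comp h1)

open Classical in
/-- The strict descendants of a node. -/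
noncomputable def descendants (x : Fin n) : Finset (Fin n) :=
  Finset.univ.filter fun j => Relation.TransGen M.graph.Adj x j

theorem mem_descendants {x j : Fin n} :
    j ∈ M.descendants x ↔ Relation.TransGen M.graph.Adj x j := by simp [descendants]

theorem notMem_descendants_self (x : Fin n) : x ∉ M.descendants x := by
  rw [mem_descendants]; exact M.acyclic x

/-- The descendants integrate to 1 first, since neither `H` nor the mechanism of a non-descendant
involves them. Among the remaining mechanisms only that of `x` involves `z_x`. -/
theorem lmarginal_insert_descendants (x : Fin n) {H : (Fin n → ℝ) → ENNReal} (hH : Measurable H)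
    (hd : DependsOn H (M.descendants x : Set (Fin n))ᶜ) (z : Fin n → ℝ) :
    lmarginal (fun _ : Fin n => (volume : Measure ℝ)) (insert x (M.descendants x))
        (fun z => H z * ∏ i, M.emech i z) z
      = M.condLIntegral x H z * ∏ i ∈ (M.descendants x)ᶜ.erase x, M.emech i z := by
  have hprod : ∀ T : Finset (Fin n), Measurable fun z => ∏ i ∈ T, M.emech i z := fun T =>
    Finset.measurable_prod _ fun i _ => M.measurable_emech i
  have hx : x ∉ M.descendants x := M.notMem_descendants_self x
  have houter : ∀ (z w : Fin n → ℝ) i, i ∉ M.descendants x → (∀ j ∉ M.descendants x, z j = w j) →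
      M.emech i z = M.emech i w := by
    intro z w i hi h
    refine M.dependsOn_emech i fun j hj => h j ?_
    rcases hj with rfl | hj
    · exact hi
    · exact fun hj' => hi (M.mem_descendants.2 ((M.mem_descendants.1 hj').tail hj))
  have hD : ∀ z, lmarginal (fun _ : Fin n => (volume : Measure ℝ)) (M.descendants x)
      (fun z => H z * ∏ i, M.emech i z) z
      = H z * ∏ i ∈ (M.descendants x)ᶜ, M.emech i z := by
    intro z
    rw [← mul_one (H z * _), ← lmarginal_prod_kernels M.graph M.acyclic M.emech
      M.measurable_emech (fun i z w hi hj => by rw [emech, emech, M.mech_local i z w hi hj])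
      M.mech_lintegral (M.descendants x) z, lmarginal, lmarginal]
    have hmu : Measurable fun y : (M.descendants x) → ℝ =>
        ∏ i ∈ M.descendants x, M.emech i (Function.updateFinset z (M.descendants x) y) :=
      (hprod _).comp measurable_updateFinset
    rw [← lintegral_const_mul _ hmu]
    refine lintegral_congr fun y => ?_
    have hagree : ∀ j ∉ M.descendants x,
        Function.updateFinset z (M.descendants x) y j = z j := fun j hj => by
      simp [Function.updateFinset, hj]
    rw [← Finset.prod_compl_mul_prod (M.descendants x), ← mul_assoc]
    congr 2
    · exact hd fun j hj => hagree j hj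
    · exact Finset.prod_congr rfl fun i hi => houter _ _ i (Finset.mem_compl.1 hi) hagree
  have hm : Measurable fun z => H z * ∏ i, M.emech i z := hH.mul (hprod _)
  rw [lmarginal_insert _ hm hx]
  simp only [hD]
  rw [condLIntegral, ← lintegral_mul_const]
  · refine lintegral_congr fun t => ?_
    rw [← Finset.mul_prod_erase _ _ (Finset.mem_compl.2 hx), ← mul_assoc]
    congr 1
    refine Finset.prod_congr rfl fun i hi => ?_
    refine M.dependsOn_emech i fun j hj => Function.update_of_ne ?_ _ _
    rintro rfl
    rcases hj with rfl | hj
    · exact Finset.ne_of_mem_erase hi rfl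
    · exact Finset.mem_compl.1 (Finset.mem_of_mem_erase hi)
        (M.mem_descendants.2 (Relation.TransGen.single hj))
  · exact (hH.mul (M.measurable_emech x)).comp (measurable_update z)

theorem dependsOn_condLIntegral (x : Fin n) {H : (Fin n → ℝ) → ENNReal} {U : Set (Fin n)}
    (hd : DependsOn H (insert x U)) (hpa : ∀ j, M.graph.Adj j x → j ∈ U) :
    DependsOn (M.condLIntegral x H) U := by
  intro z w h
  have hagree : ∀ t, ∀ i ∈ insert x U, Function.update z x t i = Function.update w x t i := by
    intro t i hi
    by_cases hix : i = x
    · subst hix; simp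
    · simpa [hix] using h i (hi.resolve_left hix)
  refine lintegral_congr fun t => ?_
  rw [hd (hagree t), M.dependsOn_emech x fun i hi => hagree t i (hi.imp_right fun hj => hpa i hj)]

/-- Integrating out a node: in the expectation of a function that does not depend on the
descendants of `x`, the variable `z_x` may be replaced by its conditional mean. -/
theorem lintegral_condLIntegral (x : Fin n) {H : (Fin n → ℝ) → ENNReal} (hH : Measurable H)
    (hd : DependsOn H (M.descendants x : Set (Fin n))ᶜ) :
    ∫⁻ z, M.condLIntegral x H z ∂M.law = ∫⁻ z, H z ∂M.law := by
  have hprod : Measurable fun z => ∏ i, M.emech i z :=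
    Finset.measurable_prod _ fun i _ => M.measurable_emech i
  have hpa : ∀ j, M.graph.Adj j x → j ∈ ((insert x (M.descendants x) : Finset (Fin n)) :
      Set (Fin n))ᶜ := by
    intro j hj hj'
    rw [Finset.mem_coe, Finset.mem_insert, mem_descendants] at hj'
    rcases hj' with rfl | hj'
    · exact M.acyclic j (Relation.TransGen.single hj)
    · exact M.acyclic x (hj'.tail hj)
  have hdep := M.dependsOn_condLIntegral x (H := H)
    (U := ((insert x (M.descendants x) : Finset (Fin n)) : Set (Fin n))ᶜ)
    (hd.mono fun i hi => by
      by_cases h : i = x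
      · exact Or.inl h
      · right
        simpa [h] using hi) hpa
  have hm := M.measurable_condLIntegral x hH
  rw [M.lintegral_law hm, M.lintegral_law hH]
  -- Both sides have the same marginal over `x` and its descendants: `condLIntegral` is already free
  -- of `z_x`, so averaging it again over `z_x` changes nothing.
  refine lintegral_eq_of_lmarginal_eq (μ := fun _ : Fin n => (volume : Measure ℝ))
    (insert x (M.descendants x)) (hm.mul hprod) (hH.mul hprod) (funext fun z => ?_)
  rw [M.lmarginal_insert_descendants x hH hd, M.lmarginal_insert_descendants x hm
    (hdep.mono (Set.compl_subset_compl.2 (by simp)))]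
  congr 1
  rw [condLIntegral]
  have h1 : ∀ t, M.condLIntegral x H (Function.update z x t) = M.condLIntegral x H z := fun t =>
    hdep fun i hi => Function.update_of_ne (by rintro rfl; simp at hi) _ _
  simp only [h1]
  have hmx : Measurable fun t => M.emech x (Function.update z x t) :=
    (M.measurable_emech x).comp (measurable_update z)
  rw [lintegral_const_mul _ hmx]
  simp only [emech, M.mech_lintegral, mul_one]

end CausalModel

/-! ### Conditional independence and conditional expectations -/

section CondExp

variable {Ω : Type*} {m₁ m m₂ mΩ : MeasurableSpace Ω} {μ : Measure Ω} [IsFiniteMeasure μ]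

theorem integrable_indicator_one {X : Set Ω} (hX : MeasurableSet X) :
    Integrable (X.indicator fun _ => (1 : ℝ)) μ :=
  (integrable_const 1).indicator hX

/-- Tower property: conditioning on `m₂` pulls out `Y` and leaves `κ`, which conditioning on `m`
then pulls out. -/
theorem condExp_inter_of_condExp_eq (hm : m ≤ m₂) (hm₂ : m₂ ≤ mΩ) {X Y : Set Ω}
    (hX : MeasurableSet X) (hY : MeasurableSet[m₂] Y) {κ : Ω → ℝ} (hκ : StronglyMeasurable[m] κ)
    (hκX : μ⟦X | m₂⟧ =ᵐ[μ] κ) :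
    μ⟦Y ∩ X | m⟧ =ᵐ[μ] fun ω => (μ⟦Y | m⟧) ω * (μ⟦X | m⟧) ω := by
  have hκi : Integrable κ μ := integrable_condExp.congr hκX
  have hYi : Integrable (Y.indicator fun _ => (1 : ℝ)) μ := integrable_indicator_one (hm₂ _ hY)
  have hX1 : μ⟦X | m⟧ =ᵐ[μ] κ := by
    refine (condExp_condExp_of_le hm hm₂).symm.trans ((condExp_congr_ae hκX).trans ?_)
    rw [condExp_of_stronglyMeasurable (hm.trans hm₂) hκ hκi]
  have hind : (Y ∩ X).indicator (fun _ => (1 : ℝ)) = Y.indicator (X.indicator fun _ => 1) := by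
    rw [Set.indicator_indicator]
  have hmul : Y.indicator κ = (Y.indicator fun _ => (1 : ℝ)) * κ := by
    funext ω
    by_cases h : ω ∈ Y <;> simp [h]
  have h2 : μ⟦Y ∩ X | m₂⟧ =ᵐ[μ] Y.indicator κ := by
    rw [hind]
    refine (condExp_indicator (integrable_indicator_one hX) hY).trans ?_
    filter_upwards [hκX] with ω hω
    by_cases h : ω ∈ Y <;> simp [h, hω]
  have h3 : μ[Y.indicator κ | m] =ᵐ[μ] μ⟦Y | m⟧ * κ := by
    rw [hmul]
    refine condExp_mul_of_stronglyMeasurable_right hκ ?_ hYi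
    rw [← hmul]
    exact hκi.indicator (hm₂ _ hY)
  filter_upwards [condExp_condExp_of_le (f := (Y ∩ X).indicator fun _ => (1 : ℝ)) (μ := μ) hm hm₂,
    condExp_congr_ae (m := m) h2, h3, hX1] with ω e1 e2 e3 e4
  rw [← e1, e2, e3, e4, Pi.mul_apply]

theorem generateFrom_inter_eq_sup (m₁ m : MeasurableSpace Ω) :
    MeasurableSpace.generateFrom
      {B | ∃ Y A, MeasurableSet[m₁] Y ∧ MeasurableSet[m] A ∧ B = Y ∩ A} = m₁ ⊔ m := by
  refine le_antisymm (MeasurableSpace.generateFrom_le ?_) (sup_le (fun Y hY => ?_) fun A hA => ?_)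
  · rintro _ ⟨Y, A, hY, hA, rfl⟩
    exact MeasurableSet.inter ((le_sup_left : m₁ ≤ m₁ ⊔ m) _ hY)
      ((le_sup_right : m ≤ m₁ ⊔ m) _ hA)
  · exact MeasurableSpace.measurableSet_generateFrom
      ⟨Y, Set.univ, hY, MeasurableSet.univ, (Set.inter_univ Y).symm⟩
  · exact MeasurableSpace.measurableSet_generateFrom
      ⟨Set.univ, A, MeasurableSet.univ, hA, (Set.univ_inter A).symm⟩

theorem isPiSystem_inter (m₁ m : MeasurableSpace Ω) :
    IsPiSystem {B | ∃ Y A, MeasurableSet[m₁] Y ∧ MeasurableSet[m] A ∧ B = Y ∩ A} := by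
  rintro _ ⟨Y, A, hY, hA, rfl⟩ _ ⟨Y', A', hY', hA', rfl⟩ -
  exact ⟨Y ∩ Y', A ∩ A', hY.inter hY', hA.inter hA', Set.inter_inter_inter_comm _ _ _ _⟩

/-- Independence gives the defining integral identity on the rectangles `Y ∩ A`, a π-system
generating `m₁ ⊔ m`. Complements and disjoint unions extend it. -/
theorem condExp_sup_of_condExp_inter (h₁ : m₁ ≤ mΩ) (hm : m ≤ mΩ) {X : Set Ω}
    (hX : MeasurableSet X)
    (hind : ∀ Y, MeasurableSet[m₁] Y →
      μ⟦Y ∩ X | m⟧ =ᵐ[μ] fun ω => (μ⟦Y | m⟧) ω * (μ⟦X | m⟧) ω) :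
    μ⟦X | m₁ ⊔ m⟧ =ᵐ[μ] μ⟦X | m⟧ := by
  have hsup : m₁ ⊔ m ≤ mΩ := sup_le h₁ hm
  have hXi : Integrable (X.indicator fun _ => (1 : ℝ)) μ := integrable_indicator_one hX
  have hF : Integrable (μ⟦X | m⟧) μ := integrable_condExp
  have hbasic : ∀ Y A, MeasurableSet[m₁] Y → MeasurableSet[m] A →
      ∫ ω in Y ∩ A, (μ⟦X | m⟧) ω ∂μ = ∫ ω in Y ∩ A, X.indicator (fun _ => (1 : ℝ)) ω ∂μ := by
    intro Y A hY hA
    have hY' := h₁ _ hY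
    have hYi : Integrable (Y.indicator fun _ => (1 : ℝ)) μ := integrable_indicator_one hY'
    have hmul : Y.indicator (μ⟦X | m⟧) = (Y.indicator fun _ => (1 : ℝ)) * μ⟦X | m⟧ := by
      funext ω
      by_cases h : ω ∈ Y <;> simp [h]
    have hpull : μ[Y.indicator (μ⟦X | m⟧) | m] =ᵐ[μ] μ⟦Y | m⟧ * μ⟦X | m⟧ := by
      rw [hmul]
      refine condExp_mul_of_stronglyMeasurable_right stronglyMeasurable_condExp ?_ hYi
      rw [← hmul]
      exact hF.indicator hY'
    have hchain : μ[Y.indicator (μ⟦X | m⟧) | m] =ᵐ[μ] μ⟦Y ∩ X | m⟧ :=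
      hpull.trans (hind Y hY).symm
    have hswap : ∀ f : Ω → ℝ, ∫ ω in Y ∩ A, f ω ∂μ = ∫ ω in A, Y.indicator f ω ∂μ := fun f => by
      rw [setIntegral_indicator hY', Set.inter_comm]
    rw [hswap, hswap, ← setIntegral_condExp hm (hF.indicator hY') hA,
      setIntegral_congr_ae (hm _ hA) (hchain.mono fun ω h _ => h),
      setIntegral_condExp hm (integrable_indicator_one (hY'.inter hX)) hA, Set.indicator_indicator]
  have huniv : ∫ ω, (μ⟦X | m⟧) ω ∂μ = ∫ ω, X.indicator (fun _ => (1 : ℝ)) ω ∂μ :=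
    integral_condExp hm
  have hsm : StronglyMeasurable[m₁ ⊔ m] (μ⟦X | m⟧) :=
    stronglyMeasurable_condExp.mono (le_sup_right : m ≤ m₁ ⊔ m)
  refine (ae_eq_condExp_of_forall_setIntegral_eq hsup hXi (fun _ _ _ => hF.integrableOn)
    (fun B hB _ => ?_) hsm.aestronglyMeasurable).symm
  induction B, hB using MeasurableSpace.induction_on_inter
    (generateFrom_inter_eq_sup m₁ m).symm (isPiSystem_inter m₁ m) with
  | empty => simp
  | basic B hB =>
    obtain ⟨Y, A, hY, hA, rfl⟩ := hB
    exact hbasic Y A hY hA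
  | compl B hB ih =>
    have e1 := integral_add_compl (hsup _ hB) hF
    have e2 := integral_add_compl (hsup _ hB) hXi
    have ih' := ih (measure_lt_top _ _)
    linarith
  | iUnion f hd hf ih =>
    rw [integral_iUnion (fun i => hsup _ (hf i)) hd hF.integrableOn,
      integral_iUnion (fun i => hsup _ (hf i)) hd hXi.integrableOn]
    exact tsum_congr fun i => ih i (measure_lt_top _ _)

end CondExp

/-! ### Conditional law of a node given non-descendants, and the independence criterion. -/

namespace CausalModel

variable {n : ℕ} (M : CausalModel n)

/-- The conditional probability of `Z_x ∈ s`, as a function of the other variables. -/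
noncomputable def condProb (x : Fin n) (s : Set ℝ) (z : Fin n → ℝ) : ℝ :=
  (M.condLIntegral x (Set.indicator ((fun z => z x) ⁻¹' s) 1) z).toReal

theorem condLIntegral_indicator_eq (x : Fin n) {s : Set ℝ} (hs : MeasurableSet s)
    (z : Fin n → ℝ) : M.condLIntegral x (Set.indicator ((fun z => z x) ⁻¹' s) 1) z
      = ∫⁻ t in s, M.emech x (Function.update z x t) := by
  rw [condLIntegral, ← lintegral_indicator hs]
  refine lintegral_congr fun t => ?_
  by_cases h : t ∈ s <;> simp [h]

theorem condLIntegral_indicator_le_one (x : Fin n) {s : Set ℝ} (hs : MeasurableSet s)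
    (z : Fin n → ℝ) : M.condLIntegral x (Set.indicator ((fun z => z x) ⁻¹' s) 1) z ≤ 1 := by
  rw [M.condLIntegral_indicator_eq x hs, ← M.mech_lintegral x z]
  exact setLIntegral_le_lintegral _ _

theorem measurable_condProb (x : Fin n) {s : Set ℝ} (hs : MeasurableSet s) :
    Measurable (M.condProb x s) :=
  (M.measurable_condLIntegral x
    (measurable_one.indicator (measurable_pi_apply x hs))).ennreal_toReal

theorem condProb_Ioc (x : Fin n) {a b : ℝ} (hab : a ≤ b) (z : Fin n → ℝ) :
    M.condProb x (Set.Ioc a b) z = ∫ t in a..b, M.mech x (Function.update z x t) := by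
  rw [condProb, M.condLIntegral_indicator_eq x measurableSet_Ioc,
    intervalIntegral.integral_of_le hab, integral_eq_lintegral_of_nonneg_ae
    (Filter.Eventually.of_forall fun t => (M.mech_pos x _).le)]
  · rfl
  · exact ((M.mech_contDiff x).continuous.comp
      (contDiff_update_const z x).continuous).aestronglyMeasurable

/-- Continuity later turns a.e. identities between conditional probabilities into pointwise ones;
bounded intervals make it immediate. -/
theorem continuous_condProb_Ioc (x : Fin n) {a b : ℝ} (hab : a ≤ b) :
    Continuous (M.condProb x (Set.Ioc a b)) := by
  rw [funext (M.condProb_Ioc x hab)]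
  refine intervalIntegral.continuous_parametric_intervalIntegral_of_continuous' ?_ a b
  refine (M.mech_contDiff x).continuous.comp ?_
  exact continuous_fst.update x continuous_snd

theorem dependsOn_condProb (x : Fin n) {s : Set ℝ} (hs : MeasurableSet s) {U : Set (Fin n)}
    (hd : DependsOn (M.mech x) (insert x U)) : DependsOn (M.condProb x s) U := by
  intro z w h
  rw [condProb, condProb, M.condLIntegral_indicator_eq x hs, M.condLIntegral_indicator_eq x hs]
  congr 1
  refine lintegral_congr fun t => ?_
  rw [emech, emech]
  congr 1
  refine hd fun i hi => ?_
  by_cases hix : i = x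
  · subst hix; simp
  · simpa [hix] using h i (hi.resolve_left hix)

theorem dependsOn_mech (x : Fin n) {U : Set (Fin n)} (hpa : ∀ j, M.graph.Adj j x → j ∈ U) :
    DependsOn (M.mech x) (insert x U) := fun z w h =>
  M.mech_local x z w (h x (by simp)) fun j hj => h j (Or.inr (hpa j hj))

/-- The local Markov property. A set in `coordSigma U` involves neither `z_x` nor its descendants,
so `lintegral_condLIntegral` verifies the defining integral identity. -/
theorem condExp_coordSigma (x : Fin n) {U : Finset (Fin n)} (hx : x ∉ U)
    (hpa : ∀ j, M.graph.Adj j x → j ∈ U) (hU : ∀ j ∈ U, j ∉ M.descendants x) {s : Set ℝ}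
    (hs : MeasurableSet s) :
    M.law⟦(fun z : Fin n → ℝ => z x) ⁻¹' s | coordSigma U⟧ =ᵐ[M.law] M.condProb x s := by
  have hX : MeasurableSet ((fun z : Fin n → ℝ => z x) ⁻¹' s) := measurable_pi_apply x hs
  have hbound : ∀ z, ‖M.condProb x s z‖ ≤ 1 := fun z => by
    rw [condProb, Real.norm_of_nonneg ENNReal.toReal_nonneg]
    exact ENNReal.toReal_mono ENNReal.one_ne_top (M.condLIntegral_indicator_le_one x hs z)
  have hint : Integrable (M.condProb x s) M.law :=
    Integrable.of_bound (M.measurable_condProb x hs).aestronglyMeasurable 1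
      (Filter.Eventually.of_forall hbound)
  have hind : Measurable (Set.indicator ((fun z : Fin n → ℝ => z x) ⁻¹' s)
      (1 : (Fin n → ℝ) → ENNReal)) := measurable_one.indicator hX
  refine (ae_eq_condExp_of_forall_setIntegral_eq (coordSigma_le U) (integrable_indicator_one hX)
    (fun _ _ _ => hint.integrableOn) (fun A hA _ => ?_) ?_).symm
  · have hA' := coordSigma_le U A hA
    have hAd := dependsOn_mem_of_measurableSet hA
    have h1 : ∀ z, A.indicator
        (M.condLIntegral x (Set.indicator ((fun z => z x) ⁻¹' s) 1)) z
        = M.condLIntegral x (Set.indicator (A ∩ (fun z => z x) ⁻¹' s) 1) z := by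
      intro z
      have h2 : ∀ t, (Function.update z x t ∈ A) = (z ∈ A) := fun t =>
        hAd fun i hi => Function.update_of_ne (by rintro rfl; exact hx hi) _ _
      by_cases hz : z ∈ A
      · rw [Set.indicator_of_mem hz]
        refine lintegral_congr fun t => ?_
        have h3 : Function.update z x t ∈ A := (h2 t).symm ▸ hz
        by_cases h4 : t ∈ s <;> simp [h3, h4]
      · rw [Set.indicator_of_notMem hz, condLIntegral]
        symm
        rw [lintegral_eq_zero_iff']
        · refine Filter.Eventually.of_forall fun t => ?_
          have h3 : Function.update z x t ∉ A := (h2 t).symm ▸ hz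
          simp [Set.indicator, h3]
        · exact (((measurable_one.indicator (hA'.inter hX)).mul (M.measurable_emech x)).comp
            (measurable_update z)).aemeasurable
    have h4 : ∫⁻ z in A, M.condLIntegral x (Set.indicator ((fun z => z x) ⁻¹' s) 1) z ∂M.law
        = M.law (A ∩ (fun z => z x) ⁻¹' s) := by
      rw [← lintegral_indicator hA', lintegral_congr h1, M.lintegral_condLIntegral x
        (measurable_one.indicator (hA'.inter hX)), lintegral_indicator_one (hA'.inter hX)]
      intro z w h
      have e1 : (z ∈ A) = (w ∈ A) := hAd fun i hi => h i (hU i hi)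
      have e2 : z x = w x := h x (M.notMem_descendants_self x)
      by_cases h1 : w ∈ A <;> by_cases h2 : w x ∈ s <;> simp [e1, e2, h1, h2]
    have h5 : ∫ z in A, M.condProb x s z ∂M.law
        = (∫⁻ z in A, M.condLIntegral x (Set.indicator ((fun z => z x) ⁻¹' s) 1) z ∂M.law).toReal :=
      integral_toReal (M.measurable_condLIntegral x hind).aemeasurable
        (Filter.Eventually.of_forall fun z =>
          (M.condLIntegral_indicator_le_one x hs z).trans_lt ENNReal.one_lt_top)
    rw [h5, h4, setIntegral_indicator hX]
    simp [Measure.real]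
  · exact ((measurable_coordSigma_of_dependsOn (M.measurable_condProb x hs)
      (M.dependsOn_condProb x hs (M.dependsOn_mech x hpa))).stronglyMeasurable).aestronglyMeasurable

theorem dependsOn_mech_of_condProb {x k : Fin n} (hkx : k ≠ x)
    (h : ∀ a b : ℝ, a ≤ b → DependsOn (M.condProb x (Set.Ioc a b)) {k}ᶜ) :
    DependsOn (M.mech x) {k}ᶜ := by
  rw [dependsOn_compl_singleton_iff]
  intro z t
  set w := Function.update z k t with hw
  have hc : ∀ z : Fin n → ℝ, Continuous fun u => M.mech x (Function.update z x u) := fun z =>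
    (M.mech_contDiff x).continuous.comp (contDiff_update_const z x).continuous
  have hint : ∀ b, z x ≤ b → ∫ u in (z x)..b, M.mech x (Function.update w x u)
      = ∫ u in (z x)..b, M.mech x (Function.update z x u) := fun b hb => by
    rw [← M.condProb_Ioc x hb, ← M.condProb_Ioc x hb]
    exact dependsOn_compl_singleton_iff.1 (h _ b hb) z t
  -- The density at `z_x` is recovered by differentiating in the right endpoint, one-sidedly because
  -- only `b ≥ z x` is available.
  have hd : ∀ v : Fin n → ℝ, HasDerivWithinAt
      (fun b => ∫ u in (z x)..b, M.mech x (Function.update v x u))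
      (M.mech x (Function.update v x (z x))) (Set.Ici (z x)) (z x) := fun v =>
    (intervalIntegral.integral_hasDerivAt_right (by simp)
      ((hc v).stronglyMeasurableAtFilter _ _) (hc v).continuousAt).hasDerivWithinAt
  have h1 : M.mech x (Function.update w x (z x)) = M.mech x (Function.update z x (z x)) :=
    (uniqueDiffWithinAt_Ici (z x)).eq_deriv _ (hd w)
      ((hd z).congr (fun b hb => hint b hb) (hint _ le_rfl))
  have h2 : Function.update w x (z x) = w := by
    have : w x = z x := by rw [hw, Function.update_of_ne hkx.symm]
    rw [← this, Function.update_eq_self]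
  rwa [h2, Function.update_eq_self] at h1

/-- Translation in direction `k` preserves null sets, so `K` agrees a.e. with its translate, hence
everywhere by continuity. -/
theorem dependsOn_of_ae_eq_dependsOn {K F : (Fin n → ℝ) → ℝ} {k : Fin n} (hK : Continuous K)
    (hF : DependsOn F {k}ᶜ) (hKF : K =ᵐ[volume] F) : DependsOn K {k}ᶜ := by
  rw [dependsOn_compl_singleton_iff]
  intro z t
  let v : Fin n → ℝ := Pi.single k (t - z k)
  have h1 : ∀ᵐ y : Fin n → ℝ, K (y + v) = F (y + v) :=
    (measurePreserving_add_right volume v).quasiMeasurePreserving.ae hKF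
  have h2 : (fun y => K (y + v)) =ᵐ[volume] K := by
    filter_upwards [h1, hKF] with y e1 e2
    rw [e1, e2]
    refine hF fun i hi => ?_
    have hi' : i ≠ k := hi
    simp [v, hi']
  have h3 := congrFun ((Continuous.ae_eq_iff_eq volume
    (hK.comp (continuous_add_const v)) hK).1 h2) z
  rw [← h3]
  simp only [Function.comp]
  congr 1
  funext i
  by_cases hi : i = k
  · subst hi; simp [v]
  · simp [v, hi]

/-- If `S ∪ {k}` contains the parents of `x` but no descendant of `x`, then `Z_k` and `Z_x` are
independent given `Z_S` if and only if the mechanism of `x` does not depend on `z_k`. -/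
theorem condIndepCoord_law_iff {x k : Fin n} {S : Finset (Fin n)} (hkx : k ≠ x) (hx : x ∉ S)
    (hk : k ∉ S) (hpa : ∀ j, M.graph.Adj j x → j ∈ insert k S)
    (hU : ∀ j ∈ insert k S, ¬ Relation.TransGen M.graph.Adj x j) :
    CondIndepCoord M.law k x S ↔ DependsOn (M.mech x) {k}ᶜ := by
  have hx' : x ∉ insert k S := by
    rw [Finset.mem_insert, not_or]
    exact ⟨hkx.symm, hx⟩
  have hcond : ∀ s : Set ℝ, MeasurableSet s →
      M.law⟦(fun z : Fin n → ℝ => z x) ⁻¹' s | coordSigma (insert k S)⟧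
        =ᵐ[M.law] M.condProb x s := fun s hs =>
    M.condExp_coordSigma x hx' hpa (fun j hj => by
      rw [mem_descendants]; exact hU j hj) hs
  rw [CondIndepCoord, condIndepFun_iff_condExp_inter_preimage_eq_mul (measurable_pi_apply k)
    (measurable_pi_apply x)]
  constructor
  · intro h
    refine M.dependsOn_mech_of_condProb hkx fun a b hab => ?_
    have hX : MeasurableSet ((fun z : Fin n → ℝ => z x) ⁻¹' Set.Ioc a b) :=
      measurable_pi_apply x measurableSet_Ioc
    have h1 := condExp_sup_of_condExp_inter (measurable_pi_apply k).comap_le (coordSigma_le S)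
      (μ := M.law) hX (by
        rintro _ ⟨s, hs, rfl⟩
        exact h s _ hs measurableSet_Ioc)
    rw [← coordSigma_insert] at h1
    -- Independence drops `z_k` from the conditioning, so the continuous kernel agrees a.e. with a
    -- function of `z_S`.
    have h2 : M.condProb x (Set.Ioc a b) =ᵐ[volume]
        M.law⟦(fun z : Fin n → ℝ => z x) ⁻¹' Set.Ioc a b | coordSigma S⟧ :=
      M.volume_absolutelyContinuous_law.ae_le ((hcond _ measurableSet_Ioc).symm.trans h1)
    refine dependsOn_of_ae_eq_dependsOn (M.continuous_condProb_Ioc x hab) ?_ h2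
    refine (dependsOn_of_measurable_coordSigma stronglyMeasurable_condExp.measurable).mono ?_
    intro i hi
    rintro rfl
    exact hk hi
  · intro h s t hs ht
    refine condExp_inter_of_condExp_eq (coordSigma_mono (Finset.subset_insert k S))
      (coordSigma_le _) (measurable_pi_apply x ht) ?_ ?_ (hcond t ht)
    · rw [coordSigma_insert]
      exact (le_sup_left : _ ≤ _ ⊔ coordSigma S) _ ⟨s, hs, rfl⟩
    · refine (measurable_coordSigma_of_dependsOn (M.measurable_condProb x ht)
        (M.dependsOn_condProb x ht ?_)).stronglyMeasurable
      -- A mechanism free of `z_k` makes the kernel `coordSigma S`-measurable, as the tower argument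
      -- requires.
      refine ((M.dependsOn_mech x (U := (insert k S : Finset (Fin n))) hpa).inter h).mono ?_
      rintro i ⟨hi, hik⟩
      rcases hi with rfl | hi
      · exact Or.inl rfl
      · exact Or.inr ((Finset.mem_insert.1 hi).resolve_left hik)

end CausalModel

/-! ### Transport of conditional independence -/

section Transport

theorem condExp_map_comp {Ω Ω' : Type*} {m mΩ' : MeasurableSpace Ω'} {mΩ : MeasurableSpace Ω}
    {μ : Measure Ω} [IsFiniteMeasure μ] (hm : m ≤ mΩ') {Ψ : Ω → Ω'} (hΨ : Measurable Ψ)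
    {F : Ω' → ℝ} (hF : Integrable F (μ.map Ψ)) :
    (fun ω => ((μ.map Ψ)[F | m]) (Ψ ω)) =ᵐ[μ] μ[fun ω => F (Ψ ω) | m.comap Ψ] := by
  have hle : m.comap Ψ ≤ mΩ := (MeasurableSpace.comap_mono hm).trans hΨ.comap_le
  have hG : Integrable ((μ.map Ψ)[F | m]) (μ.map Ψ) := integrable_condExp
  have hGc : Integrable (fun ω => ((μ.map Ψ)[F | m]) (Ψ ω)) μ :=
    (integrable_map_measure hG.aestronglyMeasurable hΨ.aemeasurable).1 hG
  have hFc : Integrable (fun ω => F (Ψ ω)) μ :=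
    (integrable_map_measure hF.aestronglyMeasurable hΨ.aemeasurable).1 hF
  refine ae_eq_condExp_of_forall_setIntegral_eq hle hFc (fun _ _ _ => hGc.integrableOn) ?_ ?_
  · rintro _ ⟨A, hA, rfl⟩ -
    rw [← setIntegral_map (hm _ hA) hG.aestronglyMeasurable hΨ.aemeasurable,
      ← setIntegral_map (hm _ hA) hF.aestronglyMeasurable hΨ.aemeasurable,
      setIntegral_condExp hm hF hA]
  · have h1 : StronglyMeasurable[m.comap Ψ] (fun ω => ((μ.map Ψ)[F | m]) (Ψ ω)) :=
      stronglyMeasurable_condExp.comp_measurable (comap_measurable Ψ)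
    exact h1.aestronglyMeasurable

variable {n : ℕ}

theorem CondIndepCoord.congr_measure {μ ν : Measure (Fin n → ℝ)} [IsFiniteMeasure μ]
    [IsFiniteMeasure ν] (h : μ = ν) (i j : Fin n) (S : Finset (Fin n)) :
    CondIndepCoord μ i j S ↔ CondIndepCoord ν i j S := by
  subst h
  exact Iff.rfl

theorem condIndepCoord_iff (μ : Measure (Fin n → ℝ)) [IsFiniteMeasure μ] (i j : Fin n)
    (S : Finset (Fin n)) : CondIndepCoord μ i j S ↔ ∀ s t : Set ℝ, MeasurableSet s →
      MeasurableSet t →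
      μ⟦(fun z : Fin n → ℝ => z i) ⁻¹' s ∩ (fun z : Fin n → ℝ => z j) ⁻¹' t | coordSigma S⟧
        =ᵐ[μ] fun z => (μ⟦(fun z : Fin n → ℝ => z i) ⁻¹' s | coordSigma S⟧) z
          * (μ⟦(fun z : Fin n → ℝ => z j) ⁻¹' t | coordSigma S⟧) z :=
  condIndepFun_iff_condExp_inter_preimage_eq_mul (measurable_pi_apply i) (measurable_pi_apply j)

/-- A measurable equivalence of the line leaves the σ-algebra generated by a coordinate unchanged,
so only the relabelling `π` survives. -/
theorem coordSigma_comap {Ψ : (Fin n → ℝ) → (Fin n → ℝ)} {π : Equiv.Perm (Fin n)}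
    {φ : Fin n → (ℝ ≃ᵐ ℝ)} (hΨ : ∀ z m, Ψ z m = φ m (z (π m))) (S : Finset (Fin n)) :
    (coordSigma S).comap Ψ = coordSigma (S.map π.toEmbedding) := by
  have h1 : ∀ k, (MeasurableSpace.comap (fun z : Fin n → ℝ => z k) inferInstance).comap Ψ
      = MeasurableSpace.comap (fun z : Fin n → ℝ => z (π k)) inferInstance := by
    intro k
    rw [MeasurableSpace.comap_comp]
    have h2 : (fun z : Fin n → ℝ => z k) ∘ Ψ = φ k ∘ fun z => z (π k) := funext fun z => hΨ z k
    rw [h2, ← MeasurableSpace.comap_comp, (φ k).measurableEmbedding.comap_eq]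
  simp only [coordSigma, MeasurableSpace.comap_iSup, h1, Finset.mem_map_equiv]
  refine Eq.trans ?_ (π.iSup_comp (g := fun k => ⨆ _ : π.symm k ∈ S,
    MeasurableSpace.comap (fun z : Fin n → ℝ => z k) inferInstance))
  simp only [Equiv.symm_apply_apply]

theorem condIndepCoord_map_iff {μ : Measure (Fin n → ℝ)} [IsFiniteMeasure μ]
    {Ψ : (Fin n → ℝ) → (Fin n → ℝ)} [IsFiniteMeasure (μ.map Ψ)] {π : Equiv.Perm (Fin n)}
    {φ : Fin n → (ℝ ≃ᵐ ℝ)} (hemb : MeasurableEmbedding Ψ) (hΨ : ∀ z m, Ψ z m = φ m (z (π m)))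
    (i j : Fin n) (S : Finset (Fin n)) :
    CondIndepCoord (μ.map Ψ) i j S ↔ CondIndepCoord μ (π i) (π j) (S.map π.toEmbedding) := by
  have hcond : ∀ X : Set (Fin n → ℝ), MeasurableSet X →
      (fun z => ((μ.map Ψ)⟦X | coordSigma S⟧) (Ψ z)) =ᵐ[μ]
        μ⟦Ψ ⁻¹' X | coordSigma (S.map π.toEmbedding)⟧ := by
    intro X hX
    have h1 := condExp_map_comp (μ := μ) (coordSigma_le S) hemb.measurable
      (integrable_indicator_one (μ := μ.map Ψ) hX)
    rw [coordSigma_comap hΨ] at h1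
    exact h1
  have hpre : ∀ k (s : Set ℝ), Ψ ⁻¹' ((fun z : Fin n → ℝ => z k) ⁻¹' s)
      = (fun z : Fin n → ℝ => z (π k)) ⁻¹' (φ k ⁻¹' s) := by
    intro k s
    ext z
    simp [hΨ]
  have key : ∀ s t : Set ℝ, MeasurableSet s → MeasurableSet t →
      (((μ.map Ψ)⟦(fun z : Fin n → ℝ => z i) ⁻¹' s ∩ (fun z : Fin n → ℝ => z j) ⁻¹' t |
        coordSigma S⟧ =ᵐ[μ.map Ψ] fun z =>
          ((μ.map Ψ)⟦(fun z : Fin n → ℝ => z i) ⁻¹' s | coordSigma S⟧) z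
          * ((μ.map Ψ)⟦(fun z : Fin n → ℝ => z j) ⁻¹' t | coordSigma S⟧) z) ↔
      (μ⟦(fun z : Fin n → ℝ => z (π i)) ⁻¹' (φ i ⁻¹' s) ∩
          (fun z : Fin n → ℝ => z (π j)) ⁻¹' (φ j ⁻¹' t) | coordSigma (S.map π.toEmbedding)⟧
        =ᵐ[μ] fun z =>
          (μ⟦(fun z : Fin n → ℝ => z (π i)) ⁻¹' (φ i ⁻¹' s) |
            coordSigma (S.map π.toEmbedding)⟧) z
          * (μ⟦(fun z : Fin n → ℝ => z (π j)) ⁻¹' (φ j ⁻¹' t) |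
            coordSigma (S.map π.toEmbedding)⟧) z)) := by
    intro s t hs ht
    have hs' : MeasurableSet ((fun z : Fin n → ℝ => z i) ⁻¹' s) := measurable_pi_apply i hs
    have ht' : MeasurableSet ((fun z : Fin n → ℝ => z j) ⁻¹' t) := measurable_pi_apply j ht
    have c1 := hcond _ (hs'.inter ht')
    have c2 := hcond _ hs'
    have c3 := hcond _ ht'
    rw [Set.preimage_inter, hpre, hpre] at c1
    rw [hpre] at c2 c3
    rw [Filter.EventuallyEq, hemb.ae_map_iff]
    constructor
    · intro h
      filter_upwards [h, c1, c2, c3] with z e e1 e2 e3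
      rw [← e1, ← e2, ← e3, e]
    · intro h
      filter_upwards [h, c1, c2, c3] with z e e1 e2 e3
      rw [e1, e2, e3, e]
  rw [condIndepCoord_iff, condIndepCoord_iff]
  constructor
  · intro h s t hs ht
    have h1 := (key _ _ ((φ i).symm.measurable hs) ((φ j).symm.measurable ht)).1
      (h _ _ ((φ i).symm.measurable hs) ((φ j).symm.measurable ht))
    simpa only [← Set.preimage_comp, MeasurableEquiv.symm_comp_self, Set.preimage_id] using h1
  · intro h s t hs ht
    exact (key s t hs ht).2 (h _ _ ((φ i).measurable hs) ((φ j).measurable ht))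

end Transport

/-! ### Minimality and additive noise -/

/-- A continuous periodic function attains its minimum, here positive, and so is bounded below by a
positive constant. -/
theorem lintegral_eq_top_of_periodic {ρ : ℝ → ℝ} (hc : Continuous ρ) (hpos : ∀ u, 0 < ρ u) {δ : ℝ}
    (hδ : δ ≠ 0) (hper : Function.Periodic ρ δ) : ∫⁻ u, ENNReal.ofReal (ρ u) = ⊤ := by
  have hcomp : IsCompact (Set.range ρ) := hper.compact_of_continuous hδ hc
  obtain ⟨c, ⟨u₀, rfl⟩, hmin⟩ := hcomp.exists_isLeast (Set.range_nonempty ρ)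
  rw [eq_top_iff]
  calc (⊤ : ENNReal) = ∫⁻ _ : ℝ, ENNReal.ofReal (ρ u₀) := by
        rw [lintegral_const, Real.volume_univ, ENNReal.mul_top]
        simpa using hpos u₀
    _ ≤ _ := lintegral_mono fun u => ENNReal.ofReal_le_ofReal (hmin ⟨u, rfl⟩)

namespace CausalModel

variable {n : ℕ} (M : CausalModel n)

theorem not_adj_self (i : Fin n) : ¬ M.graph.Adj i i := fun h =>
  M.acyclic i (Relation.TransGen.single h)

theorem dependsOn_mech_of_not_adj {l i : Fin n} (hli : l ≠ i) (h : ¬ M.graph.Adj l i) :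
    DependsOn (M.mech i) {l}ᶜ := by
  intro z w hzw
  refine M.mech_local i z w (hzw i hli.symm) fun j hj => hzw j ?_
  rintro rfl
  exact h hj

open Classical in
-- If the mechanism ignored the parent `l`, then `l` and `i` would be independent given the other
-- parents of `i`, against faithfulness.
theorem AdjacencyFaithful.not_dependsOn_mech {M : CausalModel n} (hf : M.AdjacencyFaithful)
    {l i : Fin n} (h : M.graph.Adj l i) : ¬ DependsOn (M.mech i) {l}ᶜ := by
  intro hd
  let S : Finset (Fin n) := (Finset.univ.filter fun j => M.graph.Adj j i).erase l
  have hli : l ≠ i := by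
    rintro rfl
    exact M.not_adj_self l h
  have hi : i ∉ S := by simp [S, M.not_adj_self]
  have hl : l ∉ S := by simp [S]
  have hmem : ∀ j, j ∈ insert l S ↔ M.graph.Adj j i := by
    intro j
    by_cases hj : j = l
    · subst hj; simp [h]
    · simp [S, hj]
  refine hf l i h S hl hi ((M.condIndepCoord_law_iff hli hi hl (fun j hj => (hmem j).2 hj)
    fun j hj hr => ?_).2 hd)
  exact M.acyclic i (hr.tail ((hmem j).1 hj))

/-- If moving `z_l` shifted `f` by `δ ≠ 0`, the hypothesis would make `ρ(v + δ) / ρ(v)` constant.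
Equality of total masses forces the constant 1, so `ρ` would be periodic and not integrable. -/
theorem AdditiveNoise.dependsOn_mech {M : CausalModel n} (ha : M.AdditiveNoise) {l i : Fin n}
    (hli : l ≠ i)
    (h : ∀ t, DependsOn (fun z => Real.log (M.mech i (Function.update z l t))
      - Real.log (M.mech i z)) {i}ᶜ) : DependsOn (M.mech i) {l}ᶜ := by
  obtain ⟨f, ρ, -, hfloc, hρm, hρpos, hρint, hmech⟩ := ha i
  rw [dependsOn_compl_singleton_iff]
  intro z t
  have hfi : ∀ z u, f (Function.update z i u) = f z := fun z u =>
    hfloc _ _ fun j hj => Function.update_of_ne (by rintro rfl; exact M.not_adj_self _ hj) _ _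
  have hval : ∀ z u, M.mech i (Function.update z i u) = ρ (u - f z) := fun z u => by
    rw [hmech, hfi, Function.update_self]
  by_cases hf : f (Function.update z l t) = f z
  · rw [hmech, hmech, hf, Function.update_of_ne hli.symm]
  exfalso
  set δ := f z - f (Function.update z l t) with hδ
  have hδ0 : δ ≠ 0 := sub_ne_zero.2 (Ne.symm hf)
  have hcont : Continuous ρ := by
    have h1 : ρ = fun v => M.mech i (Function.update z i (v + f z)) := by
      funext v
      rw [hval, add_sub_cancel_right]
    rw [h1]
    exact (M.mech_contDiff i).continuous.comp
      ((contDiff_update_const z i).continuous.comp (continuous_add_const _))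
  have hratio : ∀ v, ρ (v + δ) / ρ v = ρ (f z + δ - f z) / ρ (f z - f z) := by
    intro v
    have h1 := dependsOn_compl_singleton_iff.1 (h t) z
    have h2 : ∀ u, Real.log (ρ (u - f (Function.update z l t))) - Real.log (ρ (u - f z))
        = Real.log (M.mech i (Function.update z l t)) - Real.log (M.mech i z) := by
      intro u
      have h3 := h1 u
      rw [Function.update_comm hli.symm, hval, hval] at h3
      exact h3
    have h3 := (h2 (v + f z)).trans (h2 (f z)).symm
    rw [← Real.log_div (hρpos _).ne' (hρpos _).ne', ← Real.log_div (hρpos _).ne' (hρpos _).ne'] at h3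
    have h4 := Real.log_injOn_pos (div_pos (hρpos _) (hρpos _)) (div_pos (hρpos _) (hρpos _)) h3
    have e1 : v + f z - f (Function.update z l t) = v + δ := by rw [hδ]; ring
    have e2 : f z - f (Function.update z l t) = f z + δ - f z := by rw [hδ]; ring
    rw [e1, e2, add_sub_cancel_right] at h4
    exact h4
  set C := ρ (f z + δ - f z) / ρ (f z - f z) with hC
  have hCpos : 0 < C := div_pos (hρpos _) (hρpos _)
  have hmul : ∀ v, ρ (v + δ) = C * ρ v := fun v => by
    rw [← hratio v, div_mul_cancel₀ _ (hρpos v).ne']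
  have hC1 : C = 1 := by
    have h1 : ∫⁻ v, ENNReal.ofReal (ρ (v + δ)) = 1 := by
      rw [lintegral_add_right_eq_self (μ := volume) (fun v => ENNReal.ofReal (ρ v)) δ, hρint]
    simp only [hmul, ENNReal.ofReal_mul hCpos.le] at h1
    rw [lintegral_const_mul _ hρm.ennreal_ofReal, hρint, mul_one, ENNReal.ofReal_eq_one] at h1
    exact h1
  have hper : Function.Periodic ρ δ := fun v => by rw [hmul, hC1, one_mul]
  rw [lintegral_eq_top_of_periodic hcont hρpos hδ0 hper] at hρint
  exact ENNReal.top_ne_one hρint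

/-- The log-ratio of two laws with hard interventions on different nodes `i` and `j` depends on
another coordinate `l` if and only if `l` is a parent of `i` or of `j`. -/
theorem dependsOn_logRatio_iff (ha : M.AdditiveNoise) (hf : M.AdjacencyFaithful) {i j l : Fin n}
    (hij : i ≠ j) (hli : l ≠ i) (hlj : l ≠ j) (q q' : ℝ → ℝ) :
    ¬ DependsOn (fun z => (Real.log (q (z i)) - Real.log (M.mech i z))
        - (Real.log (q' (z j)) - Real.log (M.mech j z))) {l}ᶜ ↔
      M.graph.Adj l i ∨ M.graph.Adj l j := by
  constructor
  · intro h
    by_contra hno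
    rw [not_or] at hno
    refine h fun z w hzw => ?_
    have e1 : M.mech i z = M.mech i w := M.dependsOn_mech_of_not_adj hli hno.1 hzw
    have e2 : M.mech j z = M.mech j w := M.dependsOn_mech_of_not_adj hlj hno.2 hzw
    have e3 : z i = w i := hzw i hli.symm
    have e4 : z j = w j := hzw j hlj.symm
    simp only [e1, e2, e3, e4]
  · intro hadj hdep
    have hdiff : ∀ z t, Real.log (M.mech i (Function.update z l t)) - Real.log (M.mech i z)
        = Real.log (M.mech j (Function.update z l t)) - Real.log (M.mech j z) := by
      intro z t
      have h1 := dependsOn_compl_singleton_iff.1 hdep z t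
      simp only [Function.update_of_ne hli.symm, Function.update_of_ne hlj.symm] at h1
      linarith
    -- Without the edge `a → b`, the effect of `z_l` on `log p_b` is free of `z_a`, hence so is the
    -- equal effect on `log p_a`. Additive noise then excludes `l → a`.
    have hsource : ∀ a b : Fin n, l ≠ a →
        (∀ z t, Real.log (M.mech a (Function.update z l t)) - Real.log (M.mech a z)
          = Real.log (M.mech b (Function.update z l t)) - Real.log (M.mech b z)) → a ≠ b →
        M.graph.Adj l a → M.graph.Adj a b := by
      intro a b hla hd hab h1
      by_contra h2
      refine hf.not_dependsOn_mech h1 (ha.dependsOn_mech hla fun t => ?_)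
      have hb := M.dependsOn_mech_of_not_adj hab h2
      intro z w hzw
      have e1 : M.mech b z = M.mech b w := hb hzw
      have e2 : M.mech b (Function.update z l t) = M.mech b (Function.update w l t) :=
        hb fun m hm => by
          by_cases hml : m = l
          · subst hml; simp
          · simpa [hml] using hzw m hm
      simp only [hd, e1, e2]
    -- If `z_l` has no effect on `p_b`, the equality leaves none on `p_a`; cancellation thus needs
    -- both edges.
    have hone : ∀ a b : Fin n, l ≠ a →
        (∀ z t, Real.log (M.mech a (Function.update z l t)) - Real.log (M.mech a z)
          = Real.log (M.mech b (Function.update z l t)) - Real.log (M.mech b z)) → l ≠ b →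
        M.graph.Adj l a → M.graph.Adj l b := by
      intro a b hla hd hlb h1
      by_contra h2
      refine hf.not_dependsOn_mech h1 (dependsOn_compl_singleton_iff.2 fun z t => ?_)
      have h3 := hd z t
      rw [dependsOn_compl_singleton_iff.1 (M.dependsOn_mech_of_not_adj hlb h2) z t, sub_self,
        sub_eq_zero] at h3
      exact Real.log_injOn_pos (M.mech_pos _ _) (M.mech_pos _ _) h3
    have hdiff' := fun z t => (hdiff z t).symm
    have hi : M.graph.Adj l i := hadj.elim id (hone j i hlj hdiff' hli)
    have hj : M.graph.Adj l j := hadj.elim (hone i j hli hdiff hlj) id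
    exact M.acyclic i ((Relation.TransGen.single (hsource i j hli hdiff hij hi)).tail
      (hsource j i hlj hdiff' hij.symm hj))

end CausalModel

/-! ### The graph procedure -/

namespace CIProcedure

variable {n : ℕ} {α : Type*}

/-- Perform the tests attached to the elements of a list one after the other, and output a graph
that depends on the set of elements for which dependence was found. -/
def testAll (t : α → CITest n) (G : Set α → Digraph (Fin n)) : List α → Set α → CIProcedure n
  | [], D => output (G D)
  | a :: l, D => test (t a) (testAll t G l D) (testAll t G l (insert a D))

theorem numTests_testAll (t : α → CITest n) (G : Set α → Digraph (Fin n)) (l : List α)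
    (D : Set α) : (testAll t G l D).numTests = l.length := by
  induction l generalizing D with
  | nil => rfl
  | cons a l ih => simp [testAll, numTests, ih]

theorem run_testAll (o : CITest n → Prop) (t : α → CITest n) (G : Set α → Digraph (Fin n))
    (l : List α) (D : Set α) :
    (testAll t G l D).run o = G (D ∪ {a | a ∈ l ∧ ¬ o (t a)}) := by
  induction l generalizing D with
  | nil => simp [testAll, run]
  | cons a l ih =>
    by_cases h : o (t a)
    · rw [testAll, run, if_pos h, ih]
      congr 1
      ext b
      simp only [Set.mem_union, Set.mem_ofPred_eq, List.mem_cons]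
      constructor
      · rintro (hb | hb)
        · exact Or.inl hb
        · exact Or.inr ⟨Or.inr hb.1, hb.2⟩
      · rintro (hb | ⟨rfl | hb, hb'⟩)
        · exact Or.inl hb
        · exact absurd h hb'
        · exact Or.inr ⟨hb, hb'⟩
    · rw [testAll, run, if_neg h, ih]
      congr 1
      ext b
      simp only [Set.mem_union, Set.mem_ofPred_eq, List.mem_cons, Set.mem_insert_iff]
      constructor
      · rintro ((rfl | hb) | hb)
        · exact Or.inr ⟨Or.inl rfl, h⟩
        · exact Or.inl hb
        · exact Or.inr ⟨Or.inr hb.1, hb.2⟩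
      · rintro (hb | ⟨rfl | hb, hb'⟩)
        · exact Or.inl (Or.inr hb)
        · exact Or.inl (Or.inl rfl)
        · exact Or.inr ⟨hb, hb'⟩

end CIProcedure

/-! ### Reading edges off the score table, and bounding the number of tests. -/

namespace ScoreTable

variable {n : ℕ} (T : Fin n → Fin n → Fin n → Prop)

open Classical in
/-- The number of the environments in which node `k` is intervened on. -/
noncomputable def env (k : Fin n) : Fin n :=
  -- The default serves only tables without a diagonal entry for `k`; `target_env` shows that it is
  -- never reached on tables of recovered data.
  if h : ∃ a, T a a k then h.choose else k

/-- The table entry that tells whether `k` is a parent of `i` or of `j`. -/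
def ParentOfEither (i j k : Fin n) : Prop := T (env T i) (env T j) k

open Classical in
/-- The nodes whose children are not determined by the table: those that have at most one
non-child among the other nodes. -/
noncomputable def ambiguous : Finset (Fin n) :=
  Finset.univ.filter fun k => ∀ i j, i ≠ k → j ≠ k → i ≠ j → ParentOfEither T i j k

/-- The edge `k → i`, read off from the table for a node `k` that is not ambiguous. -/
def KnownEdge (k i : Fin n) : Prop :=
  i ≠ k ∧ ∀ j, j ≠ i → j ≠ k → ParentOfEither T i j k

open Classical in
/-- The conditioning set for the test of the edge from the ambiguous node `k` to `x`. -/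
noncomputable def condSet (k x : Fin n) : Finset (Fin n) :=
  -- Another ambiguous node may or may not be a parent of `x`; it is included anyway, and
  -- `not_transGen_of_mem_condSet` shows that this is harmless.
  Finset.univ.filter fun j => j ≠ k ∧ j ≠ x ∧ (j ∈ ambiguous T ∨ KnownEdge T j x)

/-- The test of the edge from the ambiguous node `k` to `x`. -/
noncomputable def edgeTest (p : Σ _ : Fin n, Fin n) : CITest n where
  second := false
  env := env T p.1
  i := p.1
  j := p.2
  S := condSet T p.1 p.2

/-- The pairs of nodes that have to be tested. -/
noncomputable def testPairs : Finset (Σ _ : Fin n, Fin n) :=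
  (ambiguous T).sigma fun k => Finset.univ.erase k

/-- The graph determined by the table and by the set of tested pairs found dependent. -/
def outputGraph (D : Set (Σ _ : Fin n, Fin n)) : Digraph (Fin n) where
  Adj a b := (a ∈ ambiguous T ∧ (⟨a, b⟩ : Σ _ : Fin n, Fin n) ∈ D) ∨
    (a ∉ ambiguous T ∧ KnownEdge T a b)

/-- Test all edges that start from an ambiguous node, provided that these are at most two nodes. -/
noncomputable def procedure : CIProcedure n :=
  -- The guard keeps the test bound valid for arbitrary tables, including those that come from no
  -- DAG.
  if (ambiguous T).card ≤ 2 then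
    CIProcedure.testAll (edgeTest T) (outputGraph T) (testPairs T).toList ∅
  else CIProcedure.output ⟨fun _ _ => False⟩

theorem numTests_procedure : (procedure T).numTests ≤ 2 * n - 1 := by
  rw [procedure]
  split_ifs with h
  · rw [CIProcedure.numTests_testAll, Finset.length_toList, testPairs, Finset.card_sigma]
    simp only [Finset.card_erase_of_mem (Finset.mem_univ _), Finset.card_univ, Fintype.card_fin,
      Finset.sum_const, smul_eq_mul]
    -- Truncated subtraction makes both bounds zero when `n = 0`.
    calc (ambiguous T).card * (n - 1) ≤ 2 * (n - 1) := Nat.mul_le_mul_right _ h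
      _ ≤ 2 * n - 1 := by omega
  · exact Nat.zero_le _

variable {T} {E : Fin n → Fin n → Prop}

theorem mem_ambiguous {k : Fin n} : k ∈ ambiguous T ↔
    ∀ i j, i ≠ k → j ≠ k → i ≠ j → ParentOfEither T i j k := by
  simp [ambiguous]

/-- The entries of the table are those of a graph with edge relation `E`. -/
def Represents (T : Fin n → Fin n → Fin n → Prop) (E : Fin n → Fin n → Prop) : Prop :=
  ∀ i j k, i ≠ j → k ≠ i → k ≠ j → (ParentOfEither T i j k ↔ E k i ∨ E k j)

theorem Represents.edge_or_edge (hT : Represents T E) {k i j : Fin n} (hk : k ∈ ambiguous T)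
    (hi : i ≠ k) (hj : j ≠ k) (hij : i ≠ j) : E k i ∨ E k j :=
  (hT i j k hij hi.symm hj.symm).1 (mem_ambiguous.1 hk i j hi hj hij)

/-- A node that is not ambiguous has two non-children `u` and `v`. Pairing `i` with one that differs
from it turns the disjunction into the single edge `k → i`. -/
theorem Represents.knownEdge_iff (hT : Represents T E) (hE : ∀ i, ¬ Relation.TransGen E i i)
    {k i : Fin n} (hk : k ∉ ambiguous T) : KnownEdge T k i ↔ E k i := by
  constructor
  · rintro ⟨hik, h⟩
    rw [mem_ambiguous] at hk
    push Not at hk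
    obtain ⟨u, v, hu, hv, huv, hno⟩ := hk
    rw [hT u v k huv hu.symm hv.symm, not_or] at hno
    by_cases hiu : u = i
    · subst hiu
      exact ((hT u v k huv hik.symm hv.symm).1 (h v huv.symm hv)).resolve_right hno.2
    · exact ((hT i u k (Ne.symm hiu) hik.symm hu.symm).1 (h u hiu hu)).resolve_right hno.1
  · intro h
    have hik : i ≠ k := by
      rintro rfl
      exact hE i (Relation.TransGen.single h)
    exact ⟨hik, fun j hji hjk => (hT i j k hji.symm hik.symm hjk.symm).2 (Or.inl h)⟩

/-- An ambiguous node with no ambiguous descendant has every other ambiguous node as a non-child,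
yet it has at most one non-child. -/
theorem Represents.card_ambiguous_le (hT : Represents T E)
    (hE : ∀ i, ¬ Relation.TransGen E i i) : (ambiguous T).card ≤ 2 := by
  by_contra! hcard
  have hwf : WellFounded (fun a b => Relation.TransGen E b a) := by
    have : IsTrans (Fin n) (fun a b => Relation.TransGen E b a) :=
      ⟨fun a b c h1 h2 => h2.trans h1⟩
    have : Std.Irrefl (fun a b => Relation.TransGen E b a) := ⟨fun a h => hE a h⟩
    exact Finite.wellFounded_of_trans_of_irrefl _
  obtain ⟨k, hk, hmin⟩ := hwf.has_min (ambiguous T : Set (Fin n))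
    (Finset.card_pos.1 (by omega : 0 < (ambiguous T).card))
  have hk' : k ∈ ambiguous T := hk
  obtain ⟨u, hu, v, hv, huv⟩ := Finset.one_lt_card.1
    (by rw [Finset.card_erase_of_mem hk']; omega : 1 < ((ambiguous T).erase k).card)
  rw [Finset.mem_erase] at hu hv
  rcases hT.edge_or_edge hk' hu.1 hv.1 huv with h | h
  · exact hmin u hu.2 (Relation.TransGen.single h)
  · exact hmin v hv.2 (Relation.TransGen.single h)

theorem Represents.mem_condSet_of_edge (hT : Represents T E)
    (hE : ∀ i, ¬ Relation.TransGen E i i) {k x j : Fin n} (hj : E j x) (hjk : j ≠ k) :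
    j ∈ condSet T k x := by
  have hjx : j ≠ x := by
    rintro rfl
    exact hE j (Relation.TransGen.single hj)
  simp only [condSet, Finset.mem_filter_univ]
  refine ⟨hjk, hjx, ?_⟩
  by_cases h : j ∈ ambiguous T
  · exact Or.inl h
  · exact Or.inr ((hT.knownEdge_iff hE h).2 hj)

/-- A known parent of `x` below `x` closes a cycle. An ambiguous `j` below `x` cannot point to `x`,
so `j → k`; then either edge allowed by the ambiguity of `k`, `k → x` or `k → j`, closes a cycle. -/
theorem Represents.not_transGen_of_mem_condSet (hT : Represents T E)
    (hE : ∀ i, ¬ Relation.TransGen E i i) {k x j : Fin n} (hk : k ∈ ambiguous T) (hkx : k ≠ x)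
    (hj : j ∈ condSet T k x) : ¬ Relation.TransGen E x j := by
  intro hr
  simp only [condSet, Finset.mem_filter_univ] at hj
  obtain ⟨hjk, hjx, hj⟩ := hj
  by_cases hja : j ∈ ambiguous T
  · have hjx' : ¬ E j x := fun h => hE x (hr.tail h)
    have hjk' : E j k := (hT.edge_or_edge hja hjx.symm hjk.symm hkx.symm).resolve_left hjx'
    rcases hT.edge_or_edge hk hkx.symm hjk hjx.symm with h | h
    · exact hE x ((hr.tail hjk').tail h)
    · exact hE j ((Relation.TransGen.single hjk').tail h)
  · exact hE x (hr.tail ((hT.knownEdge_iff hE hja).1 (hj.resolve_left hja)))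

/-- The procedure outputs the graph `E` if its tests decide the edges that they are meant for. -/
theorem Represents.run_procedure (hT : Represents T E) (hE : ∀ i, ¬ Relation.TransGen E i i)
    {o : CITest n → Prop}
    (ho : ∀ k x, k ∈ ambiguous T → k ≠ x → (o (edgeTest T ⟨k, x⟩) ↔ ¬ E k x)) (a b : Fin n) :
    ((procedure T).run o).Adj a b ↔ E a b := by
  rw [procedure, if_pos (hT.card_ambiguous_le hE), CIProcedure.run_testAll]
  simp only [outputGraph, Set.empty_union, Set.mem_ofPred_eq, Finset.mem_toList, testPairs,
    Finset.mem_sigma, Finset.mem_erase, Finset.mem_univ, and_true]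
  by_cases ha : a ∈ ambiguous T
  · simp only [ha, true_and, not_true_eq_false, false_and, or_false]
    constructor
    · rintro ⟨hba, h⟩
      by_contra h'
      exact h ((ho a b ha hba.symm).2 h')
    · intro h
      have hba : b ≠ a := by
        rintro rfl
        exact hE b (Relation.TransGen.single h)
      exact ⟨hba, fun h' => (ho a b ha hba.symm).1 h' h⟩
  · simp [ha, hT.knownEdge_iff hE ha]

end ScoreTable

/-! ### Score differences and tests for data that recover the latent variables -/

namespace CoupledModel

variable {n d : ℕ} (M : CoupledModel n d)

section Recovery

variable {h : (Fin d → ℝ) → (Fin n → ℝ)} {π : Equiv.Perm (Fin n)}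
  {φ : Fin n → Diffeomorph 𝓘(ℝ, ℝ) 𝓘(ℝ, ℝ) ℝ ℝ 1}

/-- The inverse of a coordinatewise diffeomorphism followed by a permutation. -/
noncomputable def coordInverse (π : Equiv.Perm (Fin n)) (φ : Fin n → Diffeomorph 𝓘(ℝ, ℝ) 𝓘(ℝ, ℝ) ℝ ℝ 1)
    (y : Fin n → ℝ) (i : Fin n) : ℝ :=
  (φ (π.symm i)).symm (y (π.symm i))

theorem coordInverse_apply (y : Fin n → ℝ) (m : Fin n) :
    coordInverse π φ y (π m) = (φ m).symm (y m) := by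
  simp [coordInverse]

theorem continuous_of_recovers (hφ : ∀ z m, h (M.g z) m = φ m (z (π m))) :
    Continuous fun z => h (M.g z) := by
  refine continuous_pi fun m => ?_
  simp only [hφ]
  exact (φ m).continuous.comp (continuous_apply _)

theorem contDiff_coordInverse : ContDiff ℝ 1 (coordInverse π φ) := by
  rw [contDiff_pi]
  intro i
  exact (φ (π.symm i)).symm.contMDiff.contDiff.comp (contDiff_apply ℝ ℝ (π.symm i))

theorem leftInverse_coordInverse (hφ : ∀ z m, h (M.g z) m = φ m (z (π m))) :
    Function.LeftInverse (coordInverse π φ) fun z => h (M.g z) := by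
  intro z
  funext i
  obtain ⟨m, rfl⟩ := π.surjective i
  dsimp only
  rw [coordInverse_apply, hφ, Diffeomorph.symm_apply_apply]

theorem rightInverse_coordInverse (hφ : ∀ z m, h (M.g z) m = φ m (z (π m))) :
    Function.RightInverse (coordInverse π φ) fun z => h (M.g z) := by
  intro y
  funext m
  dsimp only
  rw [hφ, coordInverse_apply, Diffeomorph.apply_symm_apply]

theorem dependsOn_comp_coordInverse_iff (hφ : ∀ z m, h (M.g z) m = φ m (z (π m)))
    {r : (Fin n → ℝ) → ℝ} {k : Fin n} :
    DependsOn (r ∘ coordInverse π φ) {k}ᶜ ↔ DependsOn r {π k}ᶜ := by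
  constructor
  · intro hd z w hzw
    have h1 : (r ∘ coordInverse π φ) (h (M.g z)) = (r ∘ coordInverse π φ) (h (M.g w)) := by
      refine hd fun i hi => ?_
      rw [hφ, hφ, hzw (π i) fun hik => hi (π.injective hik)]
    simp only [Function.comp] at h1
    rwa [M.leftInverse_coordInverse hφ z, M.leftInverse_coordInverse hφ w] at h1
  · intro hd z w hzw
    refine hd fun i hi => ?_
    obtain ⟨m, rfl⟩ := π.surjective i
    have hm : m ∈ ({k} : Set (Fin n))ᶜ := fun hmk => hi (congrArg π hmk)
    rw [coordInverse_apply, coordInverse_apply, hzw m hm]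

theorem scoreTable_self_iff_of_recovers
    (hd : ∀ i, InterventionalDiscrepancy (M.q i) (M.q' i))
    (hφ : ∀ z m, h (M.g z) m = φ m (z (π m))) (a k : Fin n) :
    scoreTable M.obsLaw M.obsLaw' h a a k ↔ M.target a = π k := by
  rw [M.scoreTable_self_iff hd (M.continuous_of_recovers hφ) contDiff_coordInverse
    (M.leftInverse_coordInverse hφ) (M.rightInverse_coordInverse hφ)]
  have h1 := M.dependsOn_comp_coordInverse_iff hφ (r := fun z => z (M.target a)) (k := k)
  rw [Function.comp_def] at h1
  rw [h1, dependsOn_compl_singleton_iff]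
  constructor
  · intro h2
    by_contra hne
    exact h2 fun z t => Function.update_of_ne hne _ _
  · intro h2 h3
    have h4 := h3 0 1
    simp [h2] at h4

theorem scoreTable_iff_of_recovers (ha : M.AdditiveNoise) (hf : M.AdjacencyFaithful)
    (hφ : ∀ z m, h (M.g z) m = φ m (z (π m))) {a b k : Fin n} (hab : a ≠ b)
    (hka : π k ≠ M.target a) (hkb : π k ≠ M.target b) :
    scoreTable M.obsLaw M.obsLaw' h a b k ↔
      M.graph.Adj (π k) (M.target a) ∨ M.graph.Adj (π k) (M.target b) := by
  rw [M.scoreTable_iff (M.continuous_of_recovers hφ) contDiff_coordInverse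
    (M.leftInverse_coordInverse hφ) (M.rightInverse_coordInverse hφ) a b k
    (M.isLogRatio_hardLaw _ _ (M.q_pdf _) (M.q'_pdf _)), M.dependsOn_comp_coordInverse_iff hφ]
  exact M.dependsOn_logRatio_iff ha hf (fun hab' => hab (M.target.injective hab')) hka hkb _ _

theorem target_env (hd : ∀ i, InterventionalDiscrepancy (M.q i) (M.q' i))
    (hφ : ∀ z m, h (M.g z) m = φ m (z (π m))) (k : Fin n) :
    M.target (ScoreTable.env (scoreTable M.obsLaw M.obsLaw' h) k) = π k := by
  have hex : ∃ a, scoreTable M.obsLaw M.obsLaw' h a a k :=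
    ⟨M.target.symm (π k), by rw [M.scoreTable_self_iff_of_recovers hd hφ]; simp⟩
  rw [ScoreTable.env, dif_pos hex]
  exact (M.scoreTable_self_iff_of_recovers hd hφ _ _).1 hex.choose_spec

theorem represents_scoreTable (hd : ∀ i, InterventionalDiscrepancy (M.q i) (M.q' i))
    (ha : M.AdditiveNoise) (hf : M.AdjacencyFaithful)
    (hφ : ∀ z m, h (M.g z) m = φ m (z (π m))) :
    ScoreTable.Represents (scoreTable M.obsLaw M.obsLaw' h)
      fun a b => M.graph.Adj (π a) (π b) := by
  intro i j k hij hki hkj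
  have hi := M.target_env hd hφ i
  have hj := M.target_env hd hφ j
  rw [ScoreTable.ParentOfEither, M.scoreTable_iff_of_recovers ha hf hφ, hi, hj]
  · intro he
    rw [he, hj] at hi
    exact hij (π.injective hi.symm)
  · rw [hi]; exact fun hk => hki (π.injective hk)
  · rw [hj]; exact fun hk => hkj (π.injective hk)

theorem transGen_of_relabel {π : Equiv.Perm (Fin n)} {a b : Fin n}
    (hab : Relation.TransGen (fun a b => M.graph.Adj (π a) (π b)) a b) :
    Relation.TransGen M.graph.Adj (π a) (π b) :=
  Relation.TransGen.lift π (fun _ _ h => h) a b hab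

theorem transGen_relabel {π : Equiv.Perm (Fin n)} {a b : Fin n}
    (hab : Relation.TransGen M.graph.Adj (π a) (π b)) :
    Relation.TransGen (fun a b => M.graph.Adj (π a) (π b)) a b := by
  have h1 : Relation.TransGen (fun a b => M.graph.Adj (π a) (π b)) (π.symm (π a))
      (π.symm (π b)) :=
    Relation.TransGen.lift π.symm (fun u v h => by simpa [Function.onFun] using h) _ _ hab
  simpa using h1

end Recovery

end CoupledModel

/-! ### Deciding edges by tests under interventions. -/

namespace CausalModel

variable {n : ℕ} (M : CausalModel n)

/-- Under a hard intervention on `k`, a conditional independence test decides whether the mechanism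
of `x` depends on `z_k`; the ancestors of `k` do not matter. -/
theorem condIndepCoord_hardLaw_iff {k x : Fin n} {q : ℝ → ℝ} (hq : IsPosPdf q)
    [IsFiniteMeasure (M.hardLaw k q)] {S : Finset (Fin n)} (hkx : k ≠ x) (hx : x ∉ S) (hk : k ∉ S)
    (hpa : ∀ j, M.graph.Adj j x → j ∈ insert k S)
    (hS : ∀ j ∈ S, ¬ Relation.TransGen M.graph.Adj x j) :
    CondIndepCoord (M.hardLaw k q) k x S ↔ DependsOn (M.mech x) {k}ᶜ := by
  rw [← CondIndepCoord.congr_measure (M.hardIntervention_law k hq) k x S,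
    (M.hardIntervention k hq).condIndepCoord_law_iff hkx hx hk (fun j hj => hpa j hj.1)]
  · simp only [hardIntervention, Function.update_of_ne hkx.symm]
  · intro j hj hr
    rcases Finset.mem_insert.1 hj with rfl | hj
    -- No directed path ends at `k` once its incoming edges are cut, even if `k` was a descendant of
    -- `x` before.
    · obtain ⟨c, -, hc⟩ := Relation.TransGen.tail'_iff.1 hr
      exact hc.2 rfl
    · exact hS j hj (Relation.TransGen.mono (fun _ _ h' => h'.1) x j hr)

end CausalModel

namespace CoupledModel

variable {n d : ℕ} (M : CoupledModel n d)

/-- The test on encoded data transports to latent coordinates under the intervention on `π k`. There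
it decides whether the mechanism of `π x` uses `z_{π k}`, which under faithfulness is the edge. -/
theorem edgeTest_holds_iff (hd : ∀ i, InterventionalDiscrepancy (M.q i) (M.q' i))
    (ha : M.AdditiveNoise) (hf : M.AdjacencyFaithful) {h : (Fin d → ℝ) → (Fin n → ℝ)}
    {π : Equiv.Perm (Fin n)} {φ : Fin n → Diffeomorph 𝓘(ℝ, ℝ) 𝓘(ℝ, ℝ) ℝ ℝ 1}
    (hφ : ∀ z m, h (M.g z) m = φ m (z (π m))) {k x : Fin n}
    (hk : k ∈ ScoreTable.ambiguous (scoreTable M.obsLaw M.obsLaw' h)) (hkx : k ≠ x) :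
    CITest.Holds M.obsLaw M.obsLaw' h
        (ScoreTable.edgeTest (scoreTable M.obsLaw M.obsLaw' h) ⟨k, x⟩)
      ↔ ¬ M.graph.Adj (π k) (π x) := by
  set T := scoreTable M.obsLaw M.obsLaw' h with hTdef
  have hT := M.represents_scoreTable hd ha hf hφ
  rw [← hTdef] at hT
  have hE : ∀ i, ¬ Relation.TransGen (fun a b => M.graph.Adj (π a) (π b)) i i := fun i hi =>
    M.acyclic _ (M.transGen_of_relabel hi)
  have hΨ := M.continuous_of_recovers hφ
  have hl := M.leftInverse_coordInverse hφ
  have hemb : MeasurableEmbedding fun z => h (M.g z) := hΨ.measurableEmbedding hl.injective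
  have htarget := M.target_env hd hφ k
  have := M.isProbabilityMeasure_hardLaw (π k) (M.q_pdf (π k))
  have hlaw : (M.obsLaw (ScoreTable.env T k)).map h
      = (M.hardLaw (π k) (M.q (π k))).map fun z => h (M.g z) := by
    rw [M.obsLaw_map hΨ.measurable, htarget]
  have hcongr := CondIndepCoord.congr_measure hlaw k x (ScoreTable.condSet T k x)
  have hmap := condIndepCoord_map_iff (μ := M.hardLaw (π k) (M.q (π k)))
    (φ := fun m => (φ m).toHomeomorph.toMeasurableEquiv) hemb hφ k x (ScoreTable.condSet T k x)
  have hkS : k ∉ ScoreTable.condSet T k x := by simp [ScoreTable.condSet]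
  have hxS : x ∉ ScoreTable.condSet T k x := by simp [ScoreTable.condSet]
  have hci := M.condIndepCoord_hardLaw_iff (M.q_pdf (π k)) (π.injective.ne hkx)
    (S := (ScoreTable.condSet T k x).map π.toEmbedding) (by simpa using hxS) (by simpa using hkS)
    (fun j hj => by
      obtain ⟨j, rfl⟩ := π.surjective j
      by_cases hjk : j = k
      · simp [hjk]
      · simpa [hjk] using hT.mem_condSet_of_edge hE hj hjk)
    (fun j hj hr => by
      obtain ⟨j, rfl⟩ := π.surjective j
      exact hT.not_transGen_of_mem_condSet hE hk hkx (by simpa using hj)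
        (M.transGen_relabel hr))
  refine (hcongr.trans (hmap.trans hci)).trans ⟨fun h1 h2 => hf.not_dependsOn_mech h2 h1, fun h1 =>
    M.dependsOn_mech_of_not_adj (π.injective.ne hkx) h1⟩

theorem run_procedure_iff (hd : ∀ i, InterventionalDiscrepancy (M.q i) (M.q' i))
    (ha : M.AdditiveNoise) (hf : M.AdjacencyFaithful) {h : (Fin d → ℝ) → (Fin n → ℝ)}
    {π : Equiv.Perm (Fin n)} (hh : M.RecoversVia h π) (a b : Fin n) :
    ((ScoreTable.procedure (scoreTable M.obsLaw M.obsLaw' h)).run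
      (CITest.Holds M.obsLaw M.obsLaw' h)).Adj a b ↔ M.graph.Adj (π a) (π b) := by
  obtain ⟨φ, hφ⟩ := hh
  exact (M.represents_scoreTable hd ha hf hφ).run_procedure
    (fun i hi => M.acyclic _ (M.transGen_of_relabel hi))
    (fun k x hk hkx => M.edgeTest_holds_iff hd ha hf hφ hk hkx) a b

end CoupledModel

open Classical in
/-- A score-based encoder for the given observation manifold and laws, if there is one. -/
noncomputable def scoreEncoder {n d : ℕ} (X : Set (Fin d → ℝ)) (P P' : Fin n → Measure (Fin d → ℝ)) :
    (Fin d → ℝ) → (Fin n → ℝ) :=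
  if h : ∃ h, IsScoreEncoder X P P' h then h.choose else 0

theorem isScoreEncoder_scoreEncoder {n d : ℕ} {X : Set (Fin d → ℝ)}
    {P P' : Fin n → Measure (Fin d → ℝ)} (h : ∃ h, IsScoreEncoder X P P' h) :
    IsScoreEncoder X P P' (scoreEncoder X P P') := by
  rw [scoreEncoder, dif_pos h]
  exact h.choose_spec

theorem mainTheorem8 (n : ℕ) :
    ∃ dag : (Fin n → Fin n → Fin n → Prop) → CIProcedure n,
      (∀ T, (dag T).numTests ≤ 2 * n - 1) ∧
      ∀ d : ℕ,
        ∃ encoder : Set (Fin d → ℝ) → (Fin n → Measure (Fin d → ℝ)) →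
            (Fin n → Measure (Fin d → ℝ)) → (Fin d → ℝ) → (Fin n → ℝ),
          ∀ M : CoupledModel n d, (∀ i, InterventionalDiscrepancy (M.q i) (M.q' i)) →
            -- latent variables: the estimator works, and so does every score-based encoder
            M.Recovers (encoder M.manifold M.obsLaw M.obsLaw') ∧
            IsScoreEncoder M.manifold M.obsLaw M.obsLaw'
              (encoder M.manifold M.obsLaw M.obsLaw') ∧
            (∀ h, IsScoreEncoder M.manifold M.obsLaw M.obsLaw' h → M.Recovers h) ∧
            -- latent DAG: recovered from score differences and few tests on the encoded data
            (M.AdditiveNoise → M.TwiceDifferentiable → M.AdjacencyFaithful →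
              ∀ h π, M.RecoversVia h π → ∀ a b,
                ((dag (scoreTable M.obsLaw M.obsLaw' h)).run
                    (CITest.Holds M.obsLaw M.obsLaw' h)).Adj a b ↔
                  M.graph.Adj (π a) (π b)) := by
  refine ⟨ScoreTable.procedure, ScoreTable.numTests_procedure, fun d =>
    ⟨scoreEncoder, fun M hd => ?_⟩⟩
  have henc := isScoreEncoder_scoreEncoder (M.exists_isScoreEncoder hd)
  exact ⟨M.recovers_of_isScoreEncoder hd henc, henc,
    fun h hh => M.recovers_of_isScoreEncoder hd hh,
    fun ha _ hf h π hh a b => M.run_procedure_iff hd ha hf hh a b⟩
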